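/- Let $n\ge 0$ and consider a convex $(n+3)$-gon with vertices labelled cyclically. A triangulation of it (without new vertices) is identified with its set of (inner) diagonals, that is, with an inclusion-maximal set of pairwise non-crossing diagonals. Let $T_0=\{\delta_1,\dots,\delta_n\}$ be a triangulation (the seed triangulation) and let $\alpha_1,\dots,\alpha_n$ be a basis of a real vector space $V$. To each diagonal $d$ of the polygon associate the vector $$v_d=-\alpha_i \ \text{ if } d=\delta_i\in T_0,\qquad v_d=\sum_{i\,:\,d\text{ crosses }\delta_i}\alpha_i\ \text{ if } d\notin T_0 .$$ Let $\mathcal F_{T_0}$ be the fan in $V$ that consists of the cones $\mathbb R_{\ge 0}T=\operatorname{cone}\{v_d : d\in T\}$, for all triangulations $T$ of the polygon, together with all faces of these cones. Theorem. $\mathcal F_{T_0}$ is the normal fan of an $n$-dimensional associahedron. That is, there is a polytope $P\subset V^*$ such that (i) $P$ is an $n$-dimensional associahedron: it is an $n$-dimensional simple polytope, and its poset of non-empty faces, ordered by inclusion, is isomorphic to the poset of non-crossing sets of diagonals of the convex $(n+3)$-gon, ordered by reverse inclusion; (ii) the normal fan of $P$ is $\mathcal F_{T_0}$: the normal cones $\{v\in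 V : g(v)\le f(v) \text{ for all } f\in F,\ g\in P\}$ of the non-empty faces $F$ of $P$ are exactly the cones of $\mathcal F_{T_0}$. -/

import Mathlib

/-! ### Polytopes, faces, simple polytopes -/

/-- A (non-empty) convex polytope in a real vector space. -/
def IsPolytope {W : Type*} [AddCommGroup W] [Module ℝ W] (P : Set W) : Prop :=
  ∃ s : Set W, s.Finite ∧ s.Nonempty ∧ P = convexHull ℝ s

/-- The dimension of (the affine span of) a non-empty set. -/
noncomputable def dimension {W : Type*} [AddCommGroup W] [Module ℝ W] (F : Set W) : ℕ :=
  Module.finrank ℝ (vectorSpan ℝ F)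

/-- `F` is a non-empty face of `P`: the non-empty set of all points of `P` at which some linear
functional attains its maximum over `P`. The zero functional gives `P` itself. -/
def IsFace {W : Type*} [AddCommGroup W] [Module ℝ W] (P F : Set W) : Prop :=
  F.Nonempty ∧ ∃ φ : Module.Dual ℝ W, F = {x | x ∈ P ∧ ∀ y ∈ P, φ y ≤ φ x}

/-- `F` is a facet of `P`: a face of codimension one. -/
def IsFacet {W : Type*} [AddCommGroup W] [Module ℝ W] (P F : Set W) : Prop :=
  IsFace P F ∧ dimension F + 1 = dimension P

/-- A polytope is simple if each of its vertices lies in exactly `dim P` facets. -/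
def IsSimple {W : Type*} [AddCommGroup W] [Module ℝ W] (P : Set W) : Prop :=
  ∀ x : W, IsFace P {x} → {F : Set W | IsFacet P F ∧ x ∈ F}.encard = dimension P

/-! ### Diagonals of a convex polygon -/

/-- The diagonals of a convex `(n + 3)`-gon whose vertices are labelled cyclically by
`0, 1, …, n + 2`: pairs `i < j` of vertices that are not cyclically adjacent. -/
abbrev Diagonal (n : ℕ) : Type :=
  {p : Fin (n + 3) × Fin (n + 3) //
    p.1.val + 1 < p.2.val ∧ ¬(p.1.val = 0 ∧ p.2.val = n + 2)}

/-- Two diagonals cross (in their interiors): their endpoints are four distinct vertices that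
alternate along the boundary of the polygon. -/
def Crosses {n : ℕ} (d e : Diagonal n) : Prop :=
  (d.1.1 < e.1.1 ∧ e.1.1 < d.1.2 ∧ d.1.2 < e.1.2) ∨
    (e.1.1 < d.1.1 ∧ d.1.1 < e.1.2 ∧ e.1.2 < d.1.2)

instance {n : ℕ} (d e : Diagonal n) : Decidable (Crosses d e) := by
  unfold Crosses
  infer_instance

/-- A set of diagonals no two of which cross. -/
def IsNonCrossing {n : ℕ} (S : Finset (Diagonal n)) : Prop :=
  ∀ d ∈ S, ∀ e ∈ S, ¬ Crosses d e

/-- A triangulation of the polygon, given by its set of diagonals: a non-crossing set of diagonals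
that is maximal with respect to inclusion. -/
def IsTriangulation {n : ℕ} (T : Finset (Diagonal n)) : Prop :=
  Maximal IsNonCrossing T

/-- An `n`-dimensional associahedron: an `n`-dimensional simple polytope whose poset of non-empty
faces is isomorphic to the poset of non-crossing sets of diagonals of a convex `(n + 3)`-gon,
ordered by reverse inclusion. -/
def IsAssociahedron {W : Type*} [AddCommGroup W] [Module ℝ W] (n : ℕ) (P : Set W) : Prop :=
  IsPolytope P ∧ dimension P = n ∧ IsSimple P ∧
    Nonempty ({F : Set W // IsFace P F} ≃o {S : Finset (Diagonal n) // IsNonCrossing S}ᵒᵈ)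

/-! ### Normal fans -/

/-- The cone of (exterior) normal vectors of `P ⊆ V*` at `F ⊆ P`: all vectors `v` of `V`, seen as
linear functionals `f ↦ f v` on `V*`, that attain their maximum over `P` at every point of `F`. -/
def normalCone {V : Type*} [AddCommGroup V] [Module ℝ V] (P F : Set (Module.Dual ℝ V)) :
    PointedCone ℝ V where
  carrier := {v | ∀ f ∈ F, ∀ g ∈ P, g v ≤ f v}
  add_mem' := by
    intro v w hv hw f hf g hg
    rw [map_add, map_add]
    exact add_le_add (hv f hf g hg) (hw f hf g hg)
  zero_mem' := by
    intro f _ g _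
    rw [map_zero, map_zero]
  smul_mem' := by
    intro c v hv f hf g hg
    have hf' : f (c • v) = (c : ℝ) * f v := map_smul f (c : ℝ) v
    have hg' : g (c • v) = (c : ℝ) * g v := map_smul g (c : ℝ) v
    rw [hf', hg']
    exact mul_le_mul_of_nonneg_left (hv f hf g hg) c.2

/-- The normal fan of a polytope `P ⊆ V*`: the collection, in the dual space `V` of `V*`, of the
normal cones of the non-empty faces of `P`. -/
def normalFan {V : Type*} [AddCommGroup V] [Module ℝ V] (P : Set (Module.Dual ℝ V)) :
    Set (PointedCone ℝ V) :=
  {C | ∃ F, IsFace P F ∧ C = normalCone P F}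

/-! ### The Santos construction -/

/-- The vector of the diagonal `d`, for a seed triangulation `T₀` and a basis `α` labelled by
the diagonals of `T₀`: it is `-α δ` if `d = δ` is a diagonal of `T₀`, and otherwise the sum of the
`α δ` over the diagonals `δ` of `T₀` crossed by `d`. -/
noncomputable def santosVector {V : Type*} [AddCommGroup V] [Module ℝ V] {n : ℕ}
    {T₀ : Finset (Diagonal n)} (α : Module.Basis {δ : Diagonal n // δ ∈ T₀} ℝ V)
    (d : Diagonal n) : V :=
  if h : d ∈ T₀ then -α ⟨d, h⟩
  else ∑ δ : {δ : Diagonal n // δ ∈ T₀}, if Crosses d δ.1 then α δ else 0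

/-- The cone generated by the vectors of the diagonals in `T`. -/
noncomputable def santosCone {V : Type*} [AddCommGroup V] [Module ℝ V] {n : ℕ}
    {T₀ : Finset (Diagonal n)} (α : Module.Basis {δ : Diagonal n // δ ∈ T₀} ℝ V)
    (T : Finset (Diagonal n)) : PointedCone ℝ V :=
  PointedCone.hull ℝ (santosVector α '' (T : Set (Diagonal n)))

/-- The fan with seed triangulation `T₀`: the cones generated by the triangulations of the polygon,
together with all their faces. -/
def santosFan {V : Type*} [AddCommGroup V] [Module ℝ V] {n : ℕ}
    {T₀ : Finset (Diagonal n)} (α : Module.Basis {δ : Diagonal n // δ ∈ T₀} ℝ V) :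
    Set (PointedCone ℝ V) :=
  {C | ∃ T : Finset (Diagonal n), IsTriangulation T ∧ C.IsFaceOf (santosCone α T)}

/-! The polytope is P = {f : f(v_d) ≤ h_d for all diagonals d}, with heights h that are strictly
convex along the fan: with N = n + 3, a diagonal (i, j) gets x(N - x) for x = j - i, and the seed
diagonals get an extra N².

Everything rests on one relation for each pair of crossing diagonals ac, bd (`hasQuadRelation`,
`hasCrossingRelation`): some s v_ac + t v_bd with s, t > 0 is a nonnegative combination of the
vectors of the sides of the quadrilateral abcd, and the heights are strictly larger on the left. It
is found by sorting the seed diagonals according to the corners of abcd that they cut off.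

Let T be a triangulation and let e cross d ∈ T. The sides of the quadrilateral of d and e meet fewer
diagonals of T than e does, so the relation permits induction on that number
(`IsTriangulation.induction_on`). It gives that the vectors of T span V, hence that all
triangulations have the same size and give bases, and that the functional equal to h on T is
strictly below h elsewhere: T is a vertex of P. Conversely, tightness at two crossing diagonals
would contradict their relation. `IsConvexPresentation` collects these facts; they imply formally
that the faces of P correspond to the non-crossing sets S, with the cone over S as normal cone. -/

/-! ### Compatibility degrees, heights and corner cuts -/

/-- Two pairs of vertices `i < j` and `k < l` cross. -/
def PairCross (i j k l : ℕ) : Prop :=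
  (i < k ∧ k < j ∧ j < l) ∨ (k < i ∧ i < l ∧ l < j)

instance (i j k l : ℕ) : Decidable (PairCross i j k l) := by
  unfold PairCross
  infer_instance

/-- The compatibility degree of two pairs of vertices: `-1` for equal pairs, `1` for crossing
pairs and `0` for all others. -/
def compat (i j k l : ℕ) : ℤ :=
  if i = k ∧ j = l then -1 else if PairCross i j k l then 1 else 0

/-- A set of pairs `k < l` no two of which cross. -/
def PairsNonCrossing (T : Set (ℕ × ℕ)) : Prop :=
  (∀ e ∈ T, e.1 < e.2) ∧ ∀ e ∈ T, ∀ f ∈ T, ¬ PairCross e.1 e.2 f.1 f.2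

open Classical in
/-- The height of the pair `i < j` in an `N`-gon with seed `T`. -/
noncomputable def pairHeight (T : Set (ℕ × ℕ)) (N i j : ℕ) : ℤ :=
  ((j : ℤ) - i) * (N - (j - i)) + if (i, j) ∈ T then (N : ℤ) ^ 2 else 0

/-- The pair `k < l` separates `b` from the other vertices of the triangle `a < b < c`, and is not
the pair `a < c`. -/
def InnerCut (a b c k l : ℕ) : Prop :=
  a ≤ k ∧ k < b ∧ b < l ∧ l ≤ c ∧ ¬ (k = a ∧ l = c)

/-- The pair `k < l` separates `d` from the other vertices of the triangle `a < c < d`, and is not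
the pair `a < c`. -/
def UpperCut (a c d k l : ℕ) : Prop :=
  (c ≤ k ∧ k < d ∧ d < l) ∨ (k ≤ a ∧ c ≤ l ∧ l < d ∧ ¬ (k = a ∧ l = c))

/-- The pair `k < l` separates `a` from the other vertices of the triangle `a < b < d`, and is not
the pair `b < d`. -/
def LowerCut (a b d k l : ℕ) : Prop :=
  (k < a ∧ a < l ∧ l ≤ b) ∨ (a < k ∧ k ≤ b ∧ d ≤ l ∧ ¬ (k = b ∧ l = d))

instance (a b c k l : ℕ) : Decidable (InnerCut a b c k l) := by
  unfold InnerCut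
  infer_instance

instance (a b c k l : ℕ) : Decidable (UpperCut a b c k l) := by
  unfold UpperCut
  infer_instance

instance (a b c k l : ℕ) : Decidable (LowerCut a b c k l) := by
  unfold LowerCut
  infer_instance

/-- A pair of `T` cutting off `b` crosses ab unless it starts at `a`, and bc unless it ends at `c`.
A pair (a, y) of `T` with b < y < c rules out the second exception, so the corner is the vector of
bc. Without such a pair the first exception is ruled out, so the corner is the vector of ab, or 0 if
ab is in `T`. The bound u + v ≤ 1 and the avoidance of `T` are what the height estimate needs. -/
theorem inner_corner {T : Set (ℕ × ℕ)} (hT : PairsNonCrossing T) {a b c : ℕ} (hab : a < b)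
    (hbc : b < c) (hac : (a, c) ∈ T) :
    ∃ u v : ℕ, u + v ≤ 1 ∧ (u ≠ 0 → (a, b) ∉ T) ∧ (v ≠ 0 → (b, c) ∉ T) ∧
      ∀ k l : ℕ, (k, l) ∈ T →
        (if InnerCut a b c k l then (1 : ℤ) else 0) =
          u * compat a b k l + v * compat b c k l := by
  have hlt : ∀ k l, (k, l) ∈ T → k < l := fun k l h => hT.1 _ h
  have hp : ∀ k l k' l', (k, l) ∈ T → (k', l') ∈ T → ¬ PairCross k l k' l' :=
    fun k l k' l' h h' => hT.2 _ h _ h'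
  unfold PairCross at hp
  unfold compat PairCross InnerCut
  by_cases h : ∃ y, b < y ∧ y < c ∧ (a, y) ∈ T
  · obtain ⟨y, hy1, hy2, hy⟩ := h
    refine ⟨0, 1, le_rfl, by simp, fun _ h => ?_, fun k l hkl => ?_⟩
    · have := hp _ _ _ _ h hy; omega
    · have h1 := hp _ _ _ _ hkl hy
      have h2 := hp _ _ _ _ hkl hac
      have h3 := hlt _ _ hkl
      push_cast
      grind
  · rename' h => hn
    by_cases hb : (a, b) ∈ T
    · refine ⟨0, 0, by simp, by simp, by simp, fun k l hkl => ?_⟩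
      have h1 := hp _ _ _ _ hkl hb
      have h2 := hp _ _ _ _ hkl hac
      have h3 := hlt _ _ hkl
      have h4 : ¬ (k = a ∧ b < l ∧ l < c) := by
        rintro ⟨rfl, h, h'⟩
        exact hn ⟨l, h, h', hkl⟩
      push_cast
      grind
    · refine ⟨1, 0, by simp, by simpa, by simp, fun k l hkl => ?_⟩
      have h2 := hp _ _ _ _ hkl hac
      have h3 := hlt _ _ hkl
      have h4 : ¬ (k = a ∧ b < l ∧ l < c) := by
        rintro ⟨rfl, h, h'⟩
        exact hn ⟨l, h, h', hkl⟩
      have h5 : ¬ (k = a ∧ l = b) := by rintro ⟨rfl, rfl⟩; exact hb hkl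
      push_cast
      grind

theorem upper_corner {T : Set (ℕ × ℕ)} (hT : PairsNonCrossing T) {a c d : ℕ} (hac' : a < c)
    (hcd : c < d) (hac : (a, c) ∈ T) :
    ∃ u v : ℕ, u + v ≤ 1 ∧ (u ≠ 0 → (c, d) ∉ T) ∧ (v ≠ 0 → (a, d) ∉ T) ∧
      ∀ k l : ℕ, (k, l) ∈ T →
        (if UpperCut a c d k l then (1 : ℤ) else 0) =
          u * compat c d k l + v * compat a d k l := by
  have hlt : ∀ k l, (k, l) ∈ T → k < l := fun k l h => hT.1 _ h
  have hp : ∀ k l k' l', (k, l) ∈ T → (k', l') ∈ T → ¬ PairCross k l k' l' :=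
    fun k l k' l' h h' => hT.2 _ h _ h'
  unfold PairCross at hp
  unfold compat PairCross UpperCut
  by_cases h : ∃ y, c < y ∧ y < d ∧ (a, y) ∈ T
  · obtain ⟨y, hy1, hy2, hy⟩ := h
    refine ⟨1, 0, le_rfl, fun _ h => ?_, by simp, fun k l hkl => ?_⟩
    · have := hp _ _ _ _ h hy; omega
    · have h1 := hp _ _ _ _ hkl hy
      have h2 := hp _ _ _ _ hkl hac
      have h3 := hlt _ _ hkl
      push_cast
      grind
  · rename' h => hn
    by_cases hb : (a, d) ∈ T
    · refine ⟨0, 0, by simp, by simp, by simp, fun k l hkl => ?_⟩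
      have h1 := hp _ _ _ _ hkl hb
      have h2 := hp _ _ _ _ hkl hac
      have h3 := hlt _ _ hkl
      have h4 : ¬ (k = a ∧ c < l ∧ l < d) := by
        rintro ⟨rfl, h, h'⟩
        exact hn ⟨l, h, h', hkl⟩
      by_cases hb' : (c, d) ∈ T
      · have h5 := hp _ _ _ _ hkl hb'
        push_cast
        grind
      · push_cast
        grind
    · refine ⟨0, 1, by simp, by simp, by simpa, fun k l hkl => ?_⟩
      have h2 := hp _ _ _ _ hkl hac
      have h3 := hlt _ _ hkl
      have h4 : ¬ (k = a ∧ c < l ∧ l < d) := by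
        rintro ⟨rfl, h, h'⟩
        exact hn ⟨l, h, h', hkl⟩
      have h5 : ¬ (k = a ∧ l = d) := by rintro ⟨rfl, rfl⟩; exact hb hkl
      push_cast
      grind

theorem lower_corner {T : Set (ℕ × ℕ)} (hT : PairsNonCrossing T) {a b d : ℕ} (hab : a < b)
    (hbd' : b < d) (hbd : (b, d) ∈ T) :
    ∃ u v : ℕ, u + v ≤ 1 ∧ (u ≠ 0 → (a, b) ∉ T) ∧ (v ≠ 0 → (a, d) ∉ T) ∧
      ∀ k l : ℕ, (k, l) ∈ T →
        (if LowerCut a b d k l then (1 : ℤ) else 0) =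
          u * compat a b k l + v * compat a d k l := by
  have hlt : ∀ k l, (k, l) ∈ T → k < l := fun k l h => hT.1 _ h
  have hp : ∀ k l k' l', (k, l) ∈ T → (k', l') ∈ T → ¬ PairCross k l k' l' :=
    fun k l k' l' h h' => hT.2 _ h _ h'
  unfold PairCross at hp
  unfold compat PairCross LowerCut
  by_cases h : ∃ y, a < y ∧ y < b ∧ (y, d) ∈ T
  · obtain ⟨y, hy1, hy2, hy⟩ := h
    refine ⟨1, 0, le_rfl, fun _ h => ?_, by simp, fun k l hkl => ?_⟩
    · have := hp _ _ _ _ h hy; omega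
    · have h1 := hp _ _ _ _ hkl hy
      have h2 := hp _ _ _ _ hkl hbd
      have h3 := hlt _ _ hkl
      push_cast
      grind
  · rename' h => hn
    by_cases hb : (a, d) ∈ T
    · refine ⟨0, 0, by simp, by simp, by simp, fun k l hkl => ?_⟩
      have h1 := hp _ _ _ _ hkl hb
      have h2 := hp _ _ _ _ hkl hbd
      have h3 := hlt _ _ hkl
      have h4 : ¬ (l = d ∧ a < k ∧ k < b) := by
        rintro ⟨rfl, h, h'⟩
        exact hn ⟨k, h, h', hkl⟩
      push_cast
      grind
    · refine ⟨0, 1, by simp, by simp, by simpa, fun k l hkl => ?_⟩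
      have h2 := hp _ _ _ _ hkl hbd
      have h3 := hlt _ _ hkl
      have h4 : ¬ (l = d ∧ a < k ∧ k < b) := by
        rintro ⟨rfl, h, h'⟩
        exact hn ⟨k, h, h', hkl⟩
      have h5 : ¬ (k = a ∧ l = d) := by rintro ⟨rfl, rfl⟩; exact hb hkl
      push_cast
      grind

/-! ### Decomposing compatibility degrees into corner cuts -/

/-- At ac itself the degrees -1 and 1 cancel. Any other pair of `T` lies on one side of ac, so if it
crosses bd it cuts off exactly one of `b`, `d`. -/
theorem compat_ac_of_mem {T : Set (ℕ × ℕ)} (hT : PairsNonCrossing T) {a b c d : ℕ} (hab : a < b)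
    (hbc : b < c) (hcd : c < d) (hac : (a, c) ∈ T) {k l : ℕ} (hkl : (k, l) ∈ T) :
    compat a c k l + compat b d k l =
      (if InnerCut a b c k l then (1 : ℤ) else 0) + (if UpperCut a c d k l then (1 : ℤ) else 0) := by
  have h1 := hT.2 _ hac _ hkl
  have h2 := hT.1 _ hkl
  unfold PairCross at h1
  unfold compat PairCross InnerCut UpperCut
  split_ifs <;> omega

theorem compat_bd_of_mem {T : Set (ℕ × ℕ)} (hT : PairsNonCrossing T) {a b c d : ℕ} (hab : a < b)
    (hbc : b < c) (hcd : c < d) (hbd : (b, d) ∈ T) {k l : ℕ} (hkl : (k, l) ∈ T) :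
    compat a c k l + compat b d k l =
      (if LowerCut a b d k l then (1 : ℤ) else 0) + (if InnerCut b c d k l then (1 : ℤ) else 0) := by
  have h1 := hT.2 _ hbd _ hkl
  have h2 := hT.1 _ hkl
  unfold PairCross at h1
  unfold compat PairCross InnerCut LowerCut
  split_ifs <;> omega

/-- A pair that crosses ac but not bd cuts off `a` or `c` alone. -/
theorem compat_ac_of_not_cross_both {a b c d : ℕ} (hab : a < b) (hbc : b < c) (hcd : c < d)
    {k l : ℕ} (hac : ¬ (k = a ∧ l = c)) (hbd : ¬ (k = b ∧ l = d))
    (h : ¬ (PairCross a c k l ∧ PairCross b d k l)) :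
    compat a c k l =
      (if LowerCut a b d k l then (1 : ℤ) else 0) + (if InnerCut b c d k l then (1 : ℤ) else 0) := by
  unfold PairCross at h
  unfold compat PairCross InnerCut LowerCut
  grind

theorem compat_bd_of_not_cross_both {a b c d : ℕ} (hab : a < b) (hbc : b < c) (hcd : c < d)
    {k l : ℕ} (hac : ¬ (k = a ∧ l = c)) (hbd : ¬ (k = b ∧ l = d))
    (h : ¬ (PairCross a c k l ∧ PairCross b d k l)) :
    compat b d k l =
      (if InnerCut a b c k l then (1 : ℤ) else 0) + (if UpperCut a c d k l then (1 : ℤ) else 0) := by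
  unfold PairCross at h
  unfold compat PairCross InnerCut UpperCut
  grind

/-- A cut at `b` prevents every cut at `a` from ending at `b`, and conversely. Hence all these cuts
cross ab, and ab itself is not in `T`. The three lemmas that follow treat the other sides alike. -/
theorem compat_ab_of_cuts {T : Set (ℕ × ℕ)} (hT : PairsNonCrossing T) {a b c d : ℕ} (hab : a < b)
    (hbc : b < c) (hcd : c < d) (hac : (a, c) ∉ T) (hbd : (b, d) ∉ T)
    (h : ∀ k l, (k, l) ∈ T → ¬ (PairCross a c k l ∧ PairCross b d k l))
    (hA : ∃ k l, (k, l) ∈ T ∧ LowerCut a b d k l) (hB : ∃ k l, (k, l) ∈ T ∧ InnerCut a b c k l)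
    {k l : ℕ} (hkl : (k, l) ∈ T) :
    compat a b k l =
      (if LowerCut a b d k l then (1 : ℤ) else 0) + (if InnerCut a b c k l then (1 : ℤ) else 0) := by
  obtain ⟨k₁, l₁, h₁, hA⟩ := hA
  obtain ⟨k₂, l₂, h₂, hB⟩ := hB
  have hA' : ∀ k l, (k, l) ∈ T → ¬ (InnerCut a b c k l ∧ k = a) := by
    intro k l hkl
    have := hT.2 _ h₁ _ hkl
    unfold InnerCut
    unfold LowerCut at hA
    unfold PairCross at this
    omega
  have hB' : ∀ k l, (k, l) ∈ T → ¬ (LowerCut a b d k l ∧ (k = b ∨ l = b)) := by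
    intro k l hkl
    have hx := hT.1 _ hkl
    have := hT.2 _ h₂ _ hkl
    unfold LowerCut
    unfold InnerCut at hB
    unfold PairCross at this
    omega
  have hn : ∀ k l, (k, l) ∈ T → ¬ (k = a ∧ l = b) := by
    intro k l hkl
    have h3 := hT.2 _ h₁ _ hkl
    have h5 := hT.1 _ h₁
    have h4 := hB' _ _ h₁
    unfold LowerCut at hA h4
    unfold PairCross at h3
    omega
  replace hA' := hA' _ _ hkl
  replace hB' := hB' _ _ hkl
  replace hn := hn _ _ hkl
  replace h := h _ _ hkl
  have hlt := hT.1 _ hkl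
  have hac' : ¬ (k = a ∧ l = c) := by rintro ⟨rfl, rfl⟩; exact hac hkl
  have hbd' : ¬ (k = b ∧ l = d) := by rintro ⟨rfl, rfl⟩; exact hbd hkl
  clear hA hB h₁ h₂
  unfold LowerCut InnerCut at *
  unfold compat PairCross at *
  grind

theorem compat_bc_of_cuts {T : Set (ℕ × ℕ)} (hT : PairsNonCrossing T) {a b c d : ℕ} (hab : a < b)
    (hbc : b < c) (hcd : c < d) (hac : (a, c) ∉ T) (hbd : (b, d) ∉ T)
    (h : ∀ k l, (k, l) ∈ T → ¬ (PairCross a c k l ∧ PairCross b d k l))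
    (hB : ∃ k l, (k, l) ∈ T ∧ InnerCut a b c k l) (hC : ∃ k l, (k, l) ∈ T ∧ InnerCut b c d k l)
    {k l : ℕ} (hkl : (k, l) ∈ T) :
    compat b c k l =
      (if InnerCut a b c k l then (1 : ℤ) else 0) + (if InnerCut b c d k l then (1 : ℤ) else 0) := by
  obtain ⟨k₁, l₁, h₁, hB⟩ := hB
  obtain ⟨k₂, l₂, h₂, hC⟩ := hC
  have hB' : ∀ k l, (k, l) ∈ T → ¬ (InnerCut b c d k l ∧ k = b) := by
    intro k l hkl
    have := hT.2 _ h₁ _ hkl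
    unfold InnerCut at hB ⊢
    unfold PairCross at this
    omega
  have hC' : ∀ k l, (k, l) ∈ T → ¬ (InnerCut a b c k l ∧ l = c) := by
    intro k l hkl
    have := hT.2 _ h₂ _ hkl
    unfold InnerCut at hC ⊢
    unfold PairCross at this
    omega
  have hn : ∀ k l, (k, l) ∈ T → ¬ (k = b ∧ l = c) := by
    intro k l hkl
    have h3 := hT.2 _ h₁ _ hkl
    have h5 := hT.1 _ h₁
    have h4 := hC' _ _ h₁
    unfold InnerCut at hB h4
    unfold PairCross at h3
    omega
  replace hB' := hB' _ _ hkl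
  replace hC' := hC' _ _ hkl
  replace hn := hn _ _ hkl
  replace h := h _ _ hkl
  have hlt := hT.1 _ hkl
  have hac' : ¬ (k = a ∧ l = c) := by rintro ⟨rfl, rfl⟩; exact hac hkl
  have hbd' : ¬ (k = b ∧ l = d) := by rintro ⟨rfl, rfl⟩; exact hbd hkl
  clear hB hC h₁ h₂
  unfold InnerCut at *
  unfold compat PairCross at *
  grind

theorem compat_cd_of_cuts {T : Set (ℕ × ℕ)} (hT : PairsNonCrossing T) {a b c d : ℕ} (hab : a < b)
    (hbc : b < c) (hcd : c < d) (hac : (a, c) ∉ T) (hbd : (b, d) ∉ T)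
    (h : ∀ k l, (k, l) ∈ T → ¬ (PairCross a c k l ∧ PairCross b d k l))
    (hC : ∃ k l, (k, l) ∈ T ∧ InnerCut b c d k l) (hD : ∃ k l, (k, l) ∈ T ∧ UpperCut a c d k l)
    {k l : ℕ} (hkl : (k, l) ∈ T) :
    compat c d k l =
      (if InnerCut b c d k l then (1 : ℤ) else 0) + (if UpperCut a c d k l then (1 : ℤ) else 0) := by
  obtain ⟨k₁, l₁, h₁, hC⟩ := hC
  obtain ⟨k₂, l₂, h₂, hD⟩ := hD
  have hC' : ∀ k l, (k, l) ∈ T → ¬ (UpperCut a c d k l ∧ (k = c ∨ l = c)) := by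
    intro k l hkl
    have hx := hT.1 _ hkl
    have := hT.2 _ h₁ _ hkl
    unfold UpperCut
    unfold InnerCut at hC
    unfold PairCross at this
    omega
  have hD' : ∀ k l, (k, l) ∈ T → ¬ (InnerCut b c d k l ∧ l = d) := by
    intro k l hkl
    have := hT.2 _ h₂ _ hkl
    unfold InnerCut
    unfold UpperCut at hD
    unfold PairCross at this
    omega
  have hn : ∀ k l, (k, l) ∈ T → ¬ (k = c ∧ l = d) := by
    intro k l hkl
    have h3 := hT.2 _ h₁ _ hkl
    have h5 := hT.1 _ h₁
    have h4 := hD' _ _ h₁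
    unfold InnerCut at hC h4
    unfold PairCross at h3
    omega
  replace hC' := hC' _ _ hkl
  replace hD' := hD' _ _ hkl
  replace hn := hn _ _ hkl
  replace h := h _ _ hkl
  have hlt := hT.1 _ hkl
  have hac' : ¬ (k = a ∧ l = c) := by rintro ⟨rfl, rfl⟩; exact hac hkl
  have hbd' : ¬ (k = b ∧ l = d) := by rintro ⟨rfl, rfl⟩; exact hbd hkl
  clear hC hD h₁ h₂
  unfold InnerCut UpperCut at *
  unfold compat PairCross at *
  grind

theorem compat_ad_of_cuts {T : Set (ℕ × ℕ)} (hT : PairsNonCrossing T) {a b c d : ℕ} (hab : a < b)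
    (hbc : b < c) (hcd : c < d) (hac : (a, c) ∉ T) (hbd : (b, d) ∉ T)
    (h : ∀ k l, (k, l) ∈ T → ¬ (PairCross a c k l ∧ PairCross b d k l))
    (hA : ∃ k l, (k, l) ∈ T ∧ LowerCut a b d k l) (hD : ∃ k l, (k, l) ∈ T ∧ UpperCut a c d k l)
    {k l : ℕ} (hkl : (k, l) ∈ T) :
    compat a d k l =
      (if LowerCut a b d k l then (1 : ℤ) else 0) + (if UpperCut a c d k l then (1 : ℤ) else 0) := by
  obtain ⟨k₁, l₁, h₁, hA⟩ := hA
  obtain ⟨k₂, l₂, h₂, hD⟩ := hD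
  have hA' : ∀ k l, (k, l) ∈ T → ¬ (UpperCut a c d k l ∧ (k = a ∨ l = a)) := by
    intro k l hkl
    have hx := hT.1 _ hkl
    have := hT.2 _ h₁ _ hkl
    unfold UpperCut
    unfold LowerCut at hA
    unfold PairCross at this
    omega
  have hD' : ∀ k l, (k, l) ∈ T → ¬ (LowerCut a b d k l ∧ l = d) := by
    intro k l hkl
    have hx := hT.1 _ hkl
    have := hT.2 _ h₂ _ hkl
    unfold LowerCut
    unfold UpperCut at hD
    unfold PairCross at this
    omega
  have hn : ∀ k l, (k, l) ∈ T → ¬ (k = a ∧ l = d) := by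
    intro k l hkl
    have h3 := hT.2 _ h₁ _ hkl
    have h5 := hT.1 _ h₁
    have h4 := hD' _ _ h₁
    unfold LowerCut at hA h4
    unfold PairCross at h3
    omega
  replace hA' := hA' _ _ hkl
  replace hD' := hD' _ _ hkl
  replace hn := hn _ _ hkl
  replace h := h _ _ hkl
  have hlt := hT.1 _ hkl
  have hac' : ¬ (k = a ∧ l = c) := by rintro ⟨rfl, rfl⟩; exact hac hkl
  have hbd' : ¬ (k = b ∧ l = d) := by rintro ⟨rfl, rfl⟩; exact hbd hkl
  clear hA hD h₁ h₂
  unfold LowerCut UpperCut at *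
  unfold compat PairCross at *
  grind

/-- The pair k₀l₀ meets two opposite sides, say ab and cd. Seen from the side of k₀l₀ that contains
`b` and `c`, ac is crossed like cd and bd like ab; seen from the other side the roles are exchanged.
-/
theorem compat_sum_of_cross_both {a b c d : ℕ} (hab : a < b) (hbc : b < c) (hcd : c < d)
    {k₀ l₀ : ℕ} (hp : PairCross a c k₀ l₀) (hq : PairCross b d k₀ l₀) :
    (PairCross a b k₀ l₀ ∧ PairCross c d k₀ l₀ ∧ ∀ k l, k < l → ¬ PairCross k₀ l₀ k l →
        compat a c k l + compat b d k l = compat a b k l + compat c d k l) ∨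
      (PairCross b c k₀ l₀ ∧ PairCross a d k₀ l₀ ∧ ∀ k l, k < l → ¬ PairCross k₀ l₀ k l →
        compat a c k l + compat b d k l = compat b c k l + compat a d k l) := by
  have : (a < k₀ ∧ k₀ < b ∧ c < l₀ ∧ l₀ < d) ∨ (b < k₀ ∧ k₀ < c ∧ d < l₀) ∨
      (k₀ < a ∧ b < l₀ ∧ l₀ < c) := by
    unfold PairCross at hp hq
    omega
  clear hp hq
  have hcases : ∀ k l, k < l → k₀ < l₀ → ¬ PairCross k₀ l₀ k l → (k₀ ≤ k ∧ l ≤ l₀) ∨ l ≤ k₀ ∨ l₀ ≤ k ∨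
      (k ≤ k₀ ∧ l₀ ≤ l) := by
    intro k l
    unfold PairCross
    omega
  rcases this with h | h | h
  · refine Or.inl ⟨by unfold PairCross; omega, by unfold PairCross; omega, fun k l hlt hn => ?_⟩
    unfold compat PairCross
    rcases hcases k l hlt (by omega) hn with h' | h' | h' | h' <;> grind
  · refine Or.inr ⟨by unfold PairCross; omega, by unfold PairCross; omega, fun k l hlt hn => ?_⟩
    unfold compat PairCross
    rcases hcases k l hlt (by omega) hn with h' | h' | h' | h' <;> grind
  · refine Or.inr ⟨by unfold PairCross; omega, by unfold PairCross; omega, fun k l hlt hn => ?_⟩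
    unfold compat PairCross
    rcases hcases k l hlt (by omega) hn with h' | h' | h' | h' <;> grind

/-! ### The quadrilateral relation -/

theorem not_mem_of_compat_nonneg {T : Set (ℕ × ℕ)} {i j : ℕ}
    (h : ∀ k l, (k, l) ∈ T → 0 ≤ compat i j k l) : (i, j) ∉ T := by
  intro hij
  have := h _ _ hij
  simp [compat] at this

theorem pairHeight_of_not_mem {T : Set (ℕ × ℕ)} {N i j : ℕ} (h : (i, j) ∉ T) :
    pairHeight T N i j = ((j : ℤ) - i) * (N - (j - i)) := by
  simp [pairHeight, h]

/-- The coefficients of the linear relation between the vectors of the diagonals and the sides of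
the quadrilateral `a < b < c < d`, together with the strict inequality for the heights. -/
def HasQuadRelation (T : Set (ℕ × ℕ)) (N a b c d : ℕ) : Prop :=
  ∃ s t w x y z : ℕ, 0 < s ∧ 0 < t ∧
    (∀ k l, (k, l) ∈ T → s * compat a c k l + t * compat b d k l =
      w * compat a b k l + x * compat b c k l + y * compat c d k l + z * compat a d k l) ∧
    w * pairHeight T N a b + x * pairHeight T N b c + y * pairHeight T N c d +
      z * pairHeight T N a d < s * pairHeight T N a c + t * pairHeight T N b d

theorem pairHeight_le {T : Set (ℕ × ℕ)} {N i j : ℕ} (u : ℕ) (h : u ≠ 0 → (i, j) ∉ T) :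
    4 * (u * pairHeight T N i j) ≤ u * (N : ℤ) ^ 2 := by
  rcases Nat.eq_zero_or_pos u with rfl | hu
  · simp
  · rw [pairHeight_of_not_mem (h hu.ne')]
    have : 4 * (((j : ℤ) - i) * (N - (j - i))) ≤ (N : ℤ) ^ 2 := by
      nlinarith [sq_nonneg ((N : ℤ) - 2 * (j - i))]
    have h2 := mul_le_mul_of_nonneg_left this (Int.natCast_nonneg u)
    linarith

theorem pairHeight_pos (T : Set (ℕ × ℕ)) {N i j : ℕ} (hij : i < j) (hj : j < N) :
    0 < pairHeight T N i j := by
  unfold pairHeight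
  have : 0 < ((j : ℤ) - i) * (N - (j - i)) := mul_pos (by omega) (by omega)
  split_ifs <;> positivity

/-- The corners at `b` and `d` use at most one side each, and only sides outside the seed, of height
at most N²/4. The total N²/2 stays below the bonus N² in the height of ac. -/
theorem hasQuadRelation_of_ac_mem {T : Set (ℕ × ℕ)} (hT : PairsNonCrossing T) {N a b c d : ℕ}
    (hab : a < b) (hbc : b < c) (hcd : c < d) (hN : d < N) (hac : (a, c) ∈ T) :
    HasQuadRelation T N a b c d := by
  obtain ⟨w, x, h1, hw, hx, h2⟩ := inner_corner hT hab hbc hac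
  obtain ⟨y, z, h3, hy, hz, h4⟩ := upper_corner hT (hab.trans hbc) hcd hac
  refine ⟨1, 1, w, x, y, z, one_pos, one_pos, fun k l hkl => ?_, ?_⟩
  · have := compat_ac_of_mem hT hab hbc hcd hac hkl
    rw [h2 k l hkl, h4 k l hkl] at this
    push_cast
    linarith
  · have e1 := pairHeight_le (N := N) w hw
    have e2 := pairHeight_le (N := N) x hx
    have e3 := pairHeight_le (N := N) y hy
    have e4 := pairHeight_le (N := N) z hz
    have e5 := pairHeight_pos T (i := b) (j := d) (by omega) hN
    have e6 : (N : ℤ) ^ 2 < pairHeight T N a c := by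
      have : 0 < ((c : ℤ) - a) * (N - (c - a)) := mul_pos (by omega) (by omega)
      simp [pairHeight, hac, this]
    have h1' : (w + x : ℤ) * N ^ 2 ≤ 1 * N ^ 2 :=
      mul_le_mul_of_nonneg_right (by exact_mod_cast h1) (by positivity)
    have h3' : (y + z : ℤ) * N ^ 2 ≤ 1 * N ^ 2 :=
      mul_le_mul_of_nonneg_right (by exact_mod_cast h3) (by positivity)
    push_cast
    nlinarith

theorem hasQuadRelation_of_bd_mem {T : Set (ℕ × ℕ)} (hT : PairsNonCrossing T) {N a b c d : ℕ}
    (hab : a < b) (hbc : b < c) (hcd : c < d) (hN : d < N) (hbd : (b, d) ∈ T) :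
    HasQuadRelation T N a b c d := by
  obtain ⟨w, z, h1, hw, hz, h2⟩ := lower_corner hT hab (hbc.trans hcd) hbd
  obtain ⟨x, y, h3, hx, hy, h4⟩ := inner_corner hT hbc hcd hbd
  refine ⟨1, 1, w, x, y, z, one_pos, one_pos, fun k l hkl => ?_, ?_⟩
  · have := compat_bd_of_mem hT hab hbc hcd hbd hkl
    rw [h2 k l hkl, h4 k l hkl] at this
    push_cast
    linarith
  · have e1 := pairHeight_le (N := N) w hw
    have e2 := pairHeight_le (N := N) x hx
    have e3 := pairHeight_le (N := N) y hy
    have e4 := pairHeight_le (N := N) z hz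
    have e5 := pairHeight_pos T (i := a) (j := c) (by omega) (by omega : c < N)
    have e6 : (N : ℤ) ^ 2 < pairHeight T N b d := by
      have : 0 < ((d : ℤ) - b) * (N - (d - b)) := mul_pos (by omega) (by omega)
      simp [pairHeight, hbd, this]
    have h1' : (w + z : ℤ) * N ^ 2 ≤ 1 * N ^ 2 :=
      mul_le_mul_of_nonneg_right (by exact_mod_cast h1) (by positivity)
    have h3' : (x + y : ℤ) * N ^ 2 ≤ 1 * N ^ 2 :=
      mul_le_mul_of_nonneg_right (by exact_mod_cast h3) (by positivity)
    push_cast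
    nlinarith

theorem not_mem_of_cross {T : Set (ℕ × ℕ)} (hT : PairsNonCrossing T) {i j k l : ℕ}
    (hkl : (k, l) ∈ T) (h : PairCross i j k l) : (i, j) ∉ T :=
  fun hij => hT.2 _ hij _ hkl h

/-- If neither diagonal is in `T` and no member of `T` crosses both, let A, B, C, D be the vectors
of the cuts at a, b, c, d. Then v_ac = A + C and v_bd = B + D, while a side whose two corner vectors
are nonzero is their sum. Every pattern of vanishing corners then has its own relation. -/
theorem hasQuadRelation {T : Set (ℕ × ℕ)} (hT : PairsNonCrossing T) {N a b c d : ℕ}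
    (hab : a < b) (hbc : b < c) (hcd : c < d) (hN : d < N)
    (hp : (a, c) ∈ T ∨ ∃ k l, (k, l) ∈ T ∧ PairCross a c k l)
    (hq : (b, d) ∈ T ∨ ∃ k l, (k, l) ∈ T ∧ PairCross b d k l) :
    HasQuadRelation T N a b c d := by
  by_cases hac : (a, c) ∈ T
  · exact hasQuadRelation_of_ac_mem hT hab hbc hcd hN hac
  by_cases hbd : (b, d) ∈ T
  · exact hasQuadRelation_of_bd_mem hT hab hbc hcd hN hbd
  replace hp := hp.resolve_left hac
  replace hq := hq.resolve_left hbd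
  have hc := pairHeight_of_not_mem (N := N) hac
  have hd := pairHeight_of_not_mem (N := N) hbd
  -- In terms of the four cyclic gaps p, q, r, m, with sum N, each height inequality without bonus
  -- says that a nonnegative, nonzero combination of products of two distinct gaps is positive.
  obtain ⟨p, hp0, hpe⟩ : ∃ p : ℤ, 0 < p ∧ (b : ℤ) = a + p := ⟨b - a, by omega, by omega⟩
  obtain ⟨q, hq0, hqe⟩ : ∃ q : ℤ, 0 < q ∧ (c : ℤ) = a + p + q := ⟨c - b, by omega, by omega⟩
  obtain ⟨r, hr0, hre⟩ : ∃ r : ℤ, 0 < r ∧ (d : ℤ) = a + p + q + r := ⟨d - c, by omega, by omega⟩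
  obtain ⟨m, hm0, hme⟩ : ∃ m : ℤ, 0 < m ∧ (N : ℤ) = p + q + r + m :=
    ⟨N - (p + q + r), by omega, by omega⟩
  have hpq := mul_pos hp0 hq0
  have hpr := mul_pos hp0 hr0
  have hpm := mul_pos hp0 hm0
  have hqr := mul_pos hq0 hr0
  have hqm := mul_pos hq0 hm0
  have hrm := mul_pos hr0 hm0
  by_cases hboth : ∃ k l, (k, l) ∈ T ∧ PairCross a c k l ∧ PairCross b d k l
  · obtain ⟨k₀, l₀, h0, hpc, hqc⟩ := hboth
    rcases compat_sum_of_cross_both hab hbc hcd hpc hqc with ⟨h1, h2, h⟩ | ⟨h1, h2, h⟩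
    · refine ⟨1, 1, 1, 0, 1, 0, one_pos, one_pos, fun k l hkl => ?_, ?_⟩
      · have := h k l (hT.1 _ hkl) (hT.2 _ h0 _ hkl)
        push_cast
        linarith
      · rw [hc, hd, pairHeight_of_not_mem (not_mem_of_cross hT h0 h1),
          pairHeight_of_not_mem (not_mem_of_cross hT h0 h2), hme, hre, hqe, hpe]
        push_cast
        linarith
    · refine ⟨1, 1, 0, 1, 0, 1, one_pos, one_pos, fun k l hkl => ?_, ?_⟩
      · have := h k l (hT.1 _ hkl) (hT.2 _ h0 _ hkl)
        push_cast
        linarith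
      · rw [hc, hd, pairHeight_of_not_mem (not_mem_of_cross hT h0 h1),
          pairHeight_of_not_mem (not_mem_of_cross hT h0 h2), hme, hre, hqe, hpe]
        push_cast
        linarith
  have hn : ∀ k l, (k, l) ∈ T → ¬ (PairCross a c k l ∧ PairCross b d k l) :=
    fun k l hkl h => hboth ⟨k, l, hkl, h⟩
  have eac : ∀ k l, (k, l) ∈ T → _ := fun k l hkl =>
    compat_ac_of_not_cross_both (k := k) (l := l) hab hbc hcd
      (by rintro ⟨rfl, rfl⟩; exact hac hkl) (by rintro ⟨rfl, rfl⟩; exact hbd hkl) (hn k l hkl)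
  have ebd : ∀ k l, (k, l) ∈ T → _ := fun k l hkl =>
    compat_bd_of_not_cross_both (k := k) (l := l) hab hbc hcd
      (by rintro ⟨rfl, rfl⟩; exact hac hkl) (by rintro ⟨rfl, rfl⟩; exact hbd hkl) (hn k l hkl)
  have eab := fun hA hB k l hkl => compat_ab_of_cuts hT hab hbc hcd hac hbd hn hA hB (k := k) (l := l) hkl
  have ebc := fun hB hC k l hkl => compat_bc_of_cuts hT hab hbc hcd hac hbd hn hB hC (k := k) (l := l) hkl
  have ecd := fun hC hD k l hkl => compat_cd_of_cuts hT hab hbc hcd hac hbd hn hC hD (k := k) (l := l) hkl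
  have ead := fun hA hD k l hkl => compat_ad_of_cuts hT hab hbc hcd hac hbd hn hA hD (k := k) (l := l) hkl
  have nab := fun hA hB => pairHeight_of_not_mem (N := N) (not_mem_of_compat_nonneg (T := T)
    fun k l hkl => by have := eab hA hB k l hkl; rw [this]; positivity)
  have nbc := fun hB hC => pairHeight_of_not_mem (N := N) (not_mem_of_compat_nonneg (T := T)
    fun k l hkl => by have := ebc hB hC k l hkl; rw [this]; positivity)
  have ncd := fun hC hD => pairHeight_of_not_mem (N := N) (not_mem_of_compat_nonneg (T := T)
    fun k l hkl => by have := ecd hC hD k l hkl; rw [this]; positivity)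
  have nad := fun hA hD => pairHeight_of_not_mem (N := N) (not_mem_of_compat_nonneg (T := T)
    fun k l hkl => by have := ead hA hD k l hkl; rw [this]; positivity)
  have zA : ¬ (∃ k l, (k, l) ∈ T ∧ LowerCut a b d k l) → ∀ k l, (k, l) ∈ T →
      (if LowerCut a b d k l then (1 : ℤ) else 0) = 0 := fun h k l hkl =>
    if_neg fun h' => h ⟨k, l, hkl, h'⟩
  have zB : ¬ (∃ k l, (k, l) ∈ T ∧ InnerCut a b c k l) → ∀ k l, (k, l) ∈ T →
      (if InnerCut a b c k l then (1 : ℤ) else 0) = 0 := fun h k l hkl =>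
    if_neg fun h' => h ⟨k, l, hkl, h'⟩
  have zC : ¬ (∃ k l, (k, l) ∈ T ∧ InnerCut b c d k l) → ∀ k l, (k, l) ∈ T →
      (if InnerCut b c d k l then (1 : ℤ) else 0) = 0 := fun h k l hkl =>
    if_neg fun h' => h ⟨k, l, hkl, h'⟩
  have zD : ¬ (∃ k l, (k, l) ∈ T ∧ UpperCut a c d k l) → ∀ k l, (k, l) ∈ T →
      (if UpperCut a c d k l then (1 : ℤ) else 0) = 0 := fun h k l hkl =>
    if_neg fun h' => h ⟨k, l, hkl, h'⟩
  -- Since ac is crossed by `T`, A and C cannot both vanish; likewise B and D for bd.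
  have hAC : ¬ (∃ k l, (k, l) ∈ T ∧ LowerCut a b d k l) →
      ¬ (∃ k l, (k, l) ∈ T ∧ InnerCut b c d k l) → False := by
    intro h1 h2
    obtain ⟨k, l, hkl, h⟩ := hp
    have := eac k l hkl
    rw [zA h1 k l hkl, zC h2 k l hkl] at this
    unfold compat at this
    split_ifs at this <;> omega
  have hBD : ¬ (∃ k l, (k, l) ∈ T ∧ InnerCut a b c k l) →
      ¬ (∃ k l, (k, l) ∈ T ∧ UpperCut a c d k l) → False := by
    intro h1 h2
    obtain ⟨k, l, hkl, h⟩ := hq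
    have := ebd k l hkl
    rw [zB h1 k l hkl, zD h2 k l hkl] at this
    unfold compat at this
    split_ifs at this <;> omega
  -- With no corner zero, A + B + C + D = v_ab + v_cd. With one zero, the corner opposite to it is
  -- shared by two sides, whence a coefficient 2: if D = 0, then A + C + 2B = v_ab + v_bc. With two
  -- adjacent corners zero, one side suffices.
  by_cases hA : ∃ k l, (k, l) ∈ T ∧ LowerCut a b d k l <;>
  by_cases hB : ∃ k l, (k, l) ∈ T ∧ InnerCut a b c k l <;>
  by_cases hC : ∃ k l, (k, l) ∈ T ∧ InnerCut b c d k l <;>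
  by_cases hD : ∃ k l, (k, l) ∈ T ∧ UpperCut a c d k l
  · refine ⟨1, 1, 1, 0, 1, 0, by norm_num, by norm_num, fun k l hkl => ?_, ?_⟩
    · rw [eac k l hkl, ebd k l hkl, eab hA hB k l hkl, ecd hC hD k l hkl]; push_cast; ring
    · rw [hc, hd, nab hA hB, ncd hC hD, hme, hre, hqe, hpe]; push_cast; linarith
  · refine ⟨1, 2, 1, 1, 0, 0, by norm_num, by norm_num, fun k l hkl => ?_, ?_⟩
    · rw [eac k l hkl, ebd k l hkl, eab hA hB k l hkl, ebc hB hC k l hkl, zD hD k l hkl]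
      push_cast; ring
    · rw [hc, hd, nab hA hB, nbc hB hC, hme, hre, hqe, hpe]; push_cast; linarith
  · refine ⟨2, 1, 1, 0, 0, 1, by norm_num, by norm_num, fun k l hkl => ?_, ?_⟩
    · rw [eac k l hkl, ebd k l hkl, eab hA hB k l hkl, ead hA hD k l hkl, zC hC k l hkl]
      push_cast; ring
    · rw [hc, hd, nab hA hB, nad hA hD, hme, hre, hqe, hpe]; push_cast; linarith
  · refine ⟨1, 1, 1, 0, 0, 0, by norm_num, by norm_num, fun k l hkl => ?_, ?_⟩
    · rw [eac k l hkl, ebd k l hkl, eab hA hB k l hkl, zC hC k l hkl, zD hD k l hkl]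
      push_cast; ring
    · rw [hc, hd, nab hA hB, hme, hre, hqe, hpe]; push_cast; linarith
  · refine ⟨1, 2, 0, 0, 1, 1, by norm_num, by norm_num, fun k l hkl => ?_, ?_⟩
    · rw [eac k l hkl, ebd k l hkl, ecd hC hD k l hkl, ead hA hD k l hkl, zB hB k l hkl]
      push_cast; ring
    · rw [hc, hd, ncd hC hD, nad hA hD, hme, hre, hqe, hpe]; push_cast; linarith
  · exact (hBD hB hD).elim
  · refine ⟨1, 1, 0, 0, 0, 1, by norm_num, by norm_num, fun k l hkl => ?_, ?_⟩
    · rw [eac k l hkl, ebd k l hkl, ead hA hD k l hkl, zB hB k l hkl, zC hC k l hkl]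
      push_cast; ring
    · rw [hc, hd, nad hA hD, hme, hre, hqe, hpe]; push_cast; linarith
  · exact (hBD hB hD).elim
  · refine ⟨2, 1, 0, 1, 1, 0, by norm_num, by norm_num, fun k l hkl => ?_, ?_⟩
    · rw [eac k l hkl, ebd k l hkl, ebc hB hC k l hkl, ecd hC hD k l hkl, zA hA k l hkl]
      push_cast; ring
    · rw [hc, hd, nbc hB hC, ncd hC hD, hme, hre, hqe, hpe]; push_cast; linarith
  · refine ⟨1, 1, 0, 1, 0, 0, by norm_num, by norm_num, fun k l hkl => ?_, ?_⟩
    · rw [eac k l hkl, ebd k l hkl, ebc hB hC k l hkl, zA hA k l hkl, zD hD k l hkl]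
      push_cast; ring
    · rw [hc, hd, nbc hB hC, hme, hre, hqe, hpe]; push_cast; linarith
  · exact (hAC hA hC).elim
  · exact (hAC hA hC).elim
  · refine ⟨1, 1, 0, 0, 1, 0, by norm_num, by norm_num, fun k l hkl => ?_, ?_⟩
    · rw [eac k l hkl, ebd k l hkl, ecd hC hD k l hkl, zA hA k l hkl, zB hB k l hkl]
      push_cast; ring
    · rw [hc, hd, ncd hC hD, hme, hre, hqe, hpe]; push_cast; linarith
  · exact (hBD hB hD).elim
  · exact (hAC hA hC).elim
  · exact (hAC hA hC).elim

/-! ### Polytopes from strictly convex heights on a simplicial fan -/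

/-- A family of simplicial cones spanned by the vectors `v d`, `d ∈ T`, for the maximal members `T`
of a simplicial complex `C`, together with heights `h` that are strictly convex on it. -/
structure IsConvexPresentation {V D : Type*} [AddCommGroup V] [Module ℝ V] [Fintype D]
    (n : ℕ) (v : D → V) (h : D → ℝ) (C : Finset D → Prop) : Prop where
  mono : ∀ S T, C T → S ⊆ T → C S
  empty : C ∅
  card_eq : ∀ T, Maximal C T → T.card = n
  linearIndepOn : ∀ T, Maximal C T → LinearIndepOn ℝ v (T : Set D)
  span_eq_top : ∀ T, Maximal C T → Submodule.span ℝ (v '' (T : Set D)) = ⊤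
  exists_vertex : ∀ T, Maximal C T → ∃ f : Module.Dual ℝ V,
    (∀ d ∈ T, f (v d) = h d) ∧ ∀ d ∉ T, f (v d) < h d
  tight : ∀ (f : Module.Dual ℝ V) (S : Finset D), (∀ d, f (v d) ≤ h d) →
    (∀ d ∈ S, f (v d) = h d) → C S
  bounded : ∀ f : Module.Dual ℝ V, (∀ d, f (v d) ≤ 0) → f = 0

/-- The polyhedron of all functionals bounded by `h d` on `v d`. -/
def heightPolytope {V D : Type*} [AddCommGroup V] [Module ℝ V] (v : D → V) (h : D → ℝ) :
    Set (Module.Dual ℝ V) :=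
  {f | ∀ d, f (v d) ≤ h d}

/-- The part of the polyhedron on which the inequalities labelled by `S` are tight. -/
def heightFace {V D : Type*} [AddCommGroup V] [Module ℝ V] (v : D → V) (h : D → ℝ)
    (S : Finset D) : Set (Module.Dual ℝ V) :=
  {f | f ∈ heightPolytope v h ∧ ∀ d ∈ S, f (v d) = h d}

/-- Only finitely many slack inequalities have to survive, and each does for small ε. -/
theorem exists_pos_add_smul_mem {V D : Type*} [AddCommGroup V] [Module ℝ V] [Finite D]
    {v : D → V} {h : D → ℝ} {f : Module.Dual ℝ V} (hf : f ∈ heightPolytope v h)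
    (g : Module.Dual ℝ V) (hg : ∀ d, f (v d) = h d → g (v d) ≤ 0) :
    ∃ ε : ℝ, 0 < ε ∧ f + ε • g ∈ heightPolytope v h ∧
      ∀ d, f (v d) < h d → (f + ε • g) (v d) < h d := by
  have key : ∀ᶠ ε : ℝ in nhdsWithin 0 (Set.Ioi 0), ∀ d, f (v d) < h d → (f + ε • g) (v d) < h d := by
    rw [Filter.eventually_all]
    intro d
    by_cases hd : f (v d) < h d
    · have hc : Continuous fun ε : ℝ => f (v d) + ε * g (v d) := by fun_prop
      have : ∀ᶠ ε : ℝ in nhds 0, f (v d) + ε * g (v d) < h d :=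
        hc.continuousAt.eventually_lt continuousAt_const (by simpa using hd)
      filter_upwards [nhdsWithin_le_nhds this] with ε hε _
      simpa using hε
    · exact Filter.Eventually.of_forall fun ε h' => absurd h' hd
  obtain ⟨ε, hε, hpos⟩ := (key.and self_mem_nhdsWithin).exists
  refine ⟨ε, hpos, fun d => ?_, hε⟩
  rcases (hf d).lt_or_eq with hd | hd
  · exact (hε d hd).le
  · have := mul_nonpos_of_nonneg_of_nonpos (le_of_lt (Set.mem_Ioi.mp hpos)) (hg d hd)
    simp only [LinearMap.add_apply, LinearMap.smul_apply, smul_eq_mul]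
    linarith

theorem convex_heightPolytope {V D : Type*} [AddCommGroup V] [Module ℝ V] (v : D → V)
    (h : D → ℝ) : Convex ℝ (heightPolytope v h) := by
  intro f hf g hg a b ha hb hab d
  have h1 := mul_le_mul_of_nonneg_left (hf d) ha
  have h2 := mul_le_mul_of_nonneg_left (hg d) hb
  simp only [LinearMap.add_apply, LinearMap.smul_apply, smul_eq_mul]
  calc _ ≤ a * h d + b * h d := add_le_add h1 h2
    _ = h d := by rw [← add_mul, hab, one_mul]

theorem mem_hull_image_iff {V D : Type*} [AddCommGroup V] [Module ℝ V] [Fintype D]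
    {v : D → V} {S : Finset D} {x : V} :
    x ∈ PointedCone.hull ℝ (v '' (S : Set D)) ↔
      ∃ c : D → ℝ, (∀ d, 0 ≤ c d) ∧ (∀ d ∉ S, c d = 0) ∧ x = ∑ d, c d • v d := by
  classical
  constructor
  · intro hx
    obtain ⟨c, rfl⟩ := (Submodule.mem_span_image_finset_iff_exists_fun _).1 hx
    refine ⟨fun d => if hd : d ∈ S then (c ⟨d, hd⟩ : ℝ) else 0, fun d => ?_, fun d hd => by simp [hd],
      ?_⟩
    · dsimp only
      split_ifs with hd
      · exact (c ⟨d, hd⟩).2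
      · exact le_rfl
    · rw [← Finset.sum_subset (Finset.subset_univ S) (fun d _ hd => by simp [hd]), ← Finset.sum_coe_sort S]
      refine Finset.sum_congr rfl fun d _ => ?_
      simp only [Finset.coe_mem, dite_true]
      rfl
  · rintro ⟨c, h0, hS, rfl⟩
    refine Submodule.sum_mem _ fun d _ => ?_
    by_cases hd : d ∈ S
    · exact Submodule.smul_mem _ (⟨c d, h0 d⟩ : {x : ℝ // 0 ≤ x}) (Submodule.subset_span ⟨d, hd, rfl⟩)
    · rw [hS d hd, zero_smul]
      exact Submodule.zero_mem _

theorem linearIndepOn_coeff_eq {V D : Type*} [AddCommGroup V] [Module ℝ V] [Fintype D]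
    {v : D → V} {T : Finset D} (hT : LinearIndepOn ℝ v (T : Set D)) {b c : D → ℝ}
    (hb : ∀ d ∉ T, b d = 0) (hc : ∀ d ∉ T, c d = 0) (h : ∑ d, b d • v d = ∑ d, c d • v d) :
    b = c := by
  funext d
  by_cases hd : d ∈ T
  · refine sub_eq_zero.1 (linearIndepOn_finset_iff.1 hT (fun d => b d - c d) ?_ d hd)
    rw [Finset.sum_subset (Finset.subset_univ T) (fun d _ hd => by simp [hb d hd, hc d hd])]
    simp only [sub_smul, Finset.sum_sub_distrib]
    exact sub_eq_zero.2 h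
  · rw [hb d hd, hc d hd]

/-- Coefficients over `T` are unique, and nonnegative summands of a coefficient that vanishes must
vanish. -/
theorem hull_image_isFaceOf {V D : Type*} [AddCommGroup V] [Module ℝ V] [Fintype D]
    {v : D → V} {S T : Finset D} (hT : LinearIndepOn ℝ v (T : Set D)) (hST : S ⊆ T) :
    (PointedCone.hull ℝ (v '' (S : Set D))).IsFaceOf (PointedCone.hull ℝ (v '' (T : Set D))) := by
  refine ⟨Submodule.span_mono (Set.image_mono (by exact_mod_cast hST)), fun {x y a} hx hy ha h => ?_⟩
  obtain ⟨b, hb0, hbT, rfl⟩ := mem_hull_image_iff.1 hx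
  obtain ⟨c, hc0, hcT, rfl⟩ := mem_hull_image_iff.1 hy
  obtain ⟨e, he0, heS, he⟩ := mem_hull_image_iff.1 h
  refine mem_hull_image_iff.2 ⟨b, hb0, fun d hd => ?_, rfl⟩
  have : (fun d => a * b d + c d) = e := by
    refine linearIndepOn_coeff_eq hT (fun d hd => by simp [hbT d hd, hcT d hd])
      (fun d hd => heS d fun h => hd (hST h)) ?_
    rw [← he]
    simp only [add_smul, mul_smul, Finset.sum_add_distrib, Finset.smul_sum]
  have h1 := congrFun this d
  rw [heS d hd] at h1
  have h2 := mul_nonneg ha.le (hb0 d)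
  have h3 := hc0 d
  exact (mul_eq_zero.1 (by linarith : a * b d = 0)).resolve_left ha.ne'

theorem exists_eq_hull_image_of_isFaceOf {V D : Type*} [AddCommGroup V] [Module ℝ V] [Fintype D]
    {v : D → V} {T : Finset D} {F : PointedCone ℝ V}
    (hF : F.IsFaceOf (PointedCone.hull ℝ (v '' (T : Set D)))) :
    ∃ S ⊆ T, F = PointedCone.hull ℝ (v '' (S : Set D)) := by
  classical
  refine ⟨T.filter fun d => v d ∈ F, Finset.filter_subset _ _, le_antisymm (fun x hx => ?_) ?_⟩
  · obtain ⟨c, hc0, hcT, rfl⟩ := mem_hull_image_iff.1 (hF.le hx)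
    refine mem_hull_image_iff.2 ⟨c, hc0, fun d hd => ?_, rfl⟩
    by_contra hne
    have hdT : d ∈ T := by
      by_contra h
      exact hne (hcT d h)
    refine hd (Finset.mem_filter.2 ⟨hdT, ?_⟩)
    have hmem : ∀ i ∈ T, v i ∈ PointedCone.hull ℝ (v '' (T : Set D)) :=
      fun i hi => Submodule.subset_span ⟨i, hi, rfl⟩
    rw [← Finset.add_sum_erase _ _ (Finset.mem_univ d)] at hx
    refine hF.mem_of_smul_add_mem (hmem d hdT) (Submodule.sum_mem _ fun i _ => ?_)
      (lt_of_le_of_ne (hc0 d) (Ne.symm hne)) hx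
    by_cases hi : i ∈ T
    · exact Submodule.smul_mem _ (⟨c i, hc0 i⟩ : {x : ℝ // 0 ≤ x}) (hmem i hi)
    · rw [hcT i hi, zero_smul]
      exact Submodule.zero_mem _
  · refine Submodule.span_le.2 ?_
    rintro _ ⟨d, hd, rfl⟩
    exact (Finset.mem_filter.1 hd).2

theorem heightFace_empty {V D : Type*} [AddCommGroup V] [Module ℝ V] (v : D → V) (h : D → ℝ) :
    heightFace v h ∅ = heightPolytope v h := by
  ext f
  simp [heightFace]

namespace IsConvexPresentation

variable {V D : Type*} [AddCommGroup V] [Module ℝ V] [Fintype D] {n : ℕ} {v : D → V} {h : D → ℝ}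
  {C : Finset D → Prop}

theorem exists_maximal (_ : IsConvexPresentation n v h C) {S : Finset D} (hS : C S) :
    ∃ T, S ⊆ T ∧ Maximal C T :=
  Finite.exists_le_maximal hS

theorem exists_dual (H : IsConvexPresentation n v h C) {T : Finset D} (hT : Maximal C T)
    (c : D → ℝ) : ∃ g : Module.Dual ℝ V, ∀ d ∈ T, g (v d) = c d := by
  have hs : ⊤ ≤ Submodule.span ℝ (Set.range fun d : (T : Set D) => v d) := by
    rw [← Set.image_eq_range]
    exact (H.span_eq_top T hT).ge
  let b := Module.Basis.mk (H.linearIndepOn T hT) hs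
  refine ⟨b.constr ℝ fun d => c d, fun d hd => ?_⟩
  have := b.constr_basis ℝ (fun d => c d) ⟨d, hd⟩
  rwa [show b ⟨d, hd⟩ = v d from Module.Basis.mk_apply _ _ _] at this

/-- Move from the vertex of a maximal `T` ⊇ `S` in the direction that is 0 on `S` and -1 on the rest
of `T`. -/
theorem exists_tight_iff (H : IsConvexPresentation n v h C) {S : Finset D} (hS : C S) :
    ∃ f ∈ heightPolytope v h, ∀ d, f (v d) = h d ↔ d ∈ S := by
  classical
  obtain ⟨T, hST, hT⟩ := H.exists_maximal hS
  obtain ⟨f, hf1, hf2⟩ := H.exists_vertex T hT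
  have hf : f ∈ heightPolytope v h := fun d => by
    by_cases hd : d ∈ T
    · exact (hf1 d hd).le
    · exact (hf2 d hd).le
  obtain ⟨g, hg⟩ := H.exists_dual hT fun d => if d ∈ S then 0 else -1
  have hgT : ∀ d, f (v d) = h d → d ∈ T := fun d hd => by
    by_contra hd'
    exact (hf2 d hd').ne hd
  obtain ⟨ε, hε, hm, hlt⟩ := exists_pos_add_smul_mem hf g fun d hd => by
    rw [hg d (hgT d hd)]
    split_ifs <;> norm_num
  refine ⟨_, hm, fun d => ⟨fun hd => ?_, fun hd => ?_⟩⟩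
  · by_contra hdS
    by_cases hdT : d ∈ T
    · simp only [LinearMap.add_apply, LinearMap.smul_apply, smul_eq_mul, hg d hdT, hf1 d hdT,
        if_neg hdS] at hd
      linarith
    · exact (hlt d (hf2 d hdT)).ne hd
  · simp [hg d (hST hd), hf1 d (hST hd), hd]

/-- A form of Farkas' lemma made elementary by simpliciality: expand `w` in the basis given by a
maximal `T` ⊇ `S` and test it on multiples of the dual basis. The negative of each dual vector is a
feasible direction at `f`, so the coefficients are nonnegative; off `S` the dual vector itself is
feasible too, so they vanish. -/
theorem exists_coeff_of_isMax (H : IsConvexPresentation n v h C) {f : Module.Dual ℝ V}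
    (hf : f ∈ heightPolytope v h) {S : Finset D} (hS : ∀ d, f (v d) = h d ↔ d ∈ S) {w : V}
    (hw : ∀ g ∈ heightPolytope v h, g w ≤ f w) :
    ∃ c : D → ℝ, (∀ d, 0 ≤ c d) ∧ (∀ d ∉ S, c d = 0) ∧ w = ∑ d, c d • v d := by
  classical
  obtain ⟨T, hST, hT⟩ := H.exists_maximal (H.tight f S hf fun d hd => (hS d).2 hd)
  have hwT : w ∈ Submodule.span ℝ (v '' (T : Set D)) := by rw [H.span_eq_top T hT]; trivial
  obtain ⟨c, hc⟩ := (Submodule.mem_span_image_finset_iff_exists_fun _).1 hwT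
  have hdual : ∀ g : Module.Dual ℝ V, (∀ d ∈ S, g (v d) ≤ 0) → g w ≤ 0 := by
    intro g hg
    obtain ⟨ε, hε, hm, -⟩ := exists_pos_add_smul_mem hf g fun d hd => hg d ((hS d).1 hd)
    have := hw _ hm
    simp only [LinearMap.add_apply, LinearMap.smul_apply, smul_eq_mul] at this
    nlinarith
  have heval : ∀ (a : ℝ) (e : {d // d ∈ T}), (∀ d ∈ S, (if d = e.1 then a else 0) ≤ 0) →
      c e * a ≤ 0 := by
    intro a e ha
    obtain ⟨g, hg⟩ := H.exists_dual hT fun d => if d = e.1 then a else 0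
    have := hdual g fun d hd => (hg d (hST hd)).le.trans (ha d hd)
    rw [← hc, map_sum, Finset.sum_eq_single e] at this
    · simpa [hg e.1 e.2] using this
    · intro d _ hd
      have : d.1 ≠ e.1 := fun h => hd (Subtype.ext h)
      simp [hg d.1 d.2, this]
    · simp
  refine ⟨fun d => if hd : d ∈ T then c ⟨d, hd⟩ else 0, fun d => ?_, fun d hd => ?_, ?_⟩
  · dsimp only
    split_ifs with hd
    · have := heval (-1) ⟨d, hd⟩ fun d _ => by split_ifs <;> norm_num
      linarith
    · exact le_rfl
  · dsimp only
    split_ifs with hdT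
    · have h1 := heval 1 ⟨d, hdT⟩ fun e he => by
        rw [if_neg]
        rintro rfl
        exact hd he
      have h2 := heval (-1) ⟨d, hdT⟩ fun d _ => by split_ifs <;> norm_num
      linarith
    · rfl
  · rw [← hc, ← Finset.sum_subset (Finset.subset_univ T) (fun d _ hd => by simp [hd]),
      ← Finset.sum_coe_sort T]
    refine Finset.sum_congr rfl fun d _ => ?_
    simp

theorem heightFace_nonempty (H : IsConvexPresentation n v h C) {S : Finset D} (hS : C S) :
    (heightFace v h S).Nonempty := by
  obtain ⟨f, hf, hfS⟩ := H.exists_tight_iff hS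
  exact ⟨f, hf, fun d hd => (hfS d).2 hd⟩

theorem heightFace_subset_iff (H : IsConvexPresentation n v h C) {S S' : Finset D} (hS : C S) :
    heightFace v h S ⊆ heightFace v h S' ↔ S' ⊆ S := by
  refine ⟨fun hsub d hd => ?_, fun hsub f hf => ⟨hf.1, fun d hd => hf.2 d (hsub hd)⟩⟩
  obtain ⟨f, hf, hfS⟩ := H.exists_tight_iff hS
  exact (hfS d).1 ((hsub ⟨hf, fun d hd => (hfS d).2 hd⟩).2 d hd)

theorem heightFace_injOn (H : IsConvexPresentation n v h C) {S S' : Finset D} (hS : C S)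
    (hS' : C S') (heq : heightFace v h S = heightFace v h S') : S = S' :=
  Finset.Subset.antisymm ((H.heightFace_subset_iff hS').1 heq.ge)
    ((H.heightFace_subset_iff hS).1 heq.le)

/-- The points of the polytope maximizing a positive combination of the vectors `v d`, `d ∈ S`. -/
theorem setOf_isMax_eq (H : IsConvexPresentation n v h C) {S : Finset D} (hS : C S) {c : D → ℝ}
    (hc : ∀ d ∈ S, 0 < c d) (hc0 : ∀ d ∉ S, c d = 0) :
    {f | f ∈ heightPolytope v h ∧ ∀ g ∈ heightPolytope v h,
      g (∑ d, c d • v d) ≤ f (∑ d, c d • v d)} = heightFace v h S := by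
  have hle : ∀ g ∈ heightPolytope v h, ∀ d, c d * g (v d) ≤ c d * h d := fun g hg d => by
    by_cases hd : d ∈ S
    · exact mul_le_mul_of_nonneg_left (hg d) (hc d hd).le
    · simp [hc0 d hd]
  ext f
  simp only [Set.mem_ofPred_eq, map_sum, map_smul, smul_eq_mul]
  constructor
  · rintro ⟨hf, hmax⟩
    refine ⟨hf, fun d hd => ?_⟩
    obtain ⟨g, hg, hgS⟩ := H.heightFace_nonempty hS
    have h1 : ∑ d, c d * f (v d) = ∑ d, c d * h d := by
      refine le_antisymm (Finset.sum_le_sum fun d _ => hle f hf d) (le_trans (le_of_eq ?_) (hmax g hg))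
      refine Finset.sum_congr rfl fun d _ => ?_
      by_cases hd : d ∈ S
      · rw [hgS d hd]
      · simp [hc0 d hd]
    have := (Finset.sum_eq_sum_iff_of_le fun d _ => hle f hf d).1 h1 d (Finset.mem_univ d)
    exact mul_left_cancel₀ (hc d hd).ne' this
  · rintro ⟨hf, hfS⟩
    refine ⟨hf, fun g hg => Finset.sum_le_sum fun d _ => ?_⟩
    by_cases hd : d ∈ S
    · rw [hfS d hd]
      exact hle g hg d
    · simp [hc0 d hd]

theorem finiteDimensional (H : IsConvexPresentation n v h C) : FiniteDimensional ℝ V := by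
  obtain ⟨T, -, hT⟩ := H.exists_maximal H.empty
  refine ⟨⟨(T.finite_toSet.image v).toFinset, ?_⟩⟩
  rw [Set.Finite.coe_toFinset]
  exact H.span_eq_top T hT

theorem finrank_span (H : IsConvexPresentation n v h C) {S : Finset D} (hS : C S) :
    Module.finrank ℝ (Submodule.span ℝ (v '' (S : Set D))) = S.card := by
  obtain ⟨T, hST, hT⟩ := H.exists_maximal hS
  have := (H.linearIndepOn T hT).mono (by exact_mod_cast hST : (S : Set D) ⊆ T)
  rw [Set.image_eq_range]
  simpa using finrank_span_eq_card (R := ℝ) (b := fun d : (S : Set D) => v d) this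

theorem finrank_eq (H : IsConvexPresentation n v h C) : Module.finrank ℝ V = n := by
  obtain ⟨T, -, hT⟩ := H.exists_maximal H.empty
  rw [← H.card_eq T hT, ← H.finrank_span hT.prop, H.span_eq_top T hT, finrank_top]

theorem isFace_iff (H : IsConvexPresentation n v h C) {F : Set (Module.Dual ℝ V)} :
    IsFace (heightPolytope v h) F ↔ ∃ S, C S ∧ F = heightFace v h S := by
  classical
  constructor
  · rintro ⟨⟨f, hfF⟩, φ, rfl⟩
    have := H.finiteDimensional
    -- By biduality the functional defining the face is evaluation at a vector of V.
    obtain ⟨w, rfl⟩ := (Module.evalEquiv ℝ V).surjective φ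
    simp only [Module.evalEquiv_apply, Module.Dual.eval_apply] at hfF ⊢
    obtain ⟨hf, hmax⟩ := hfF
    obtain ⟨c, hc0, hcS, rfl⟩ := H.exists_coeff_of_isMax hf
      (S := Finset.univ.filter fun d => f (v d) = h d) (by simp) hmax
    -- The face is labelled by the support of the coefficients, which may be smaller than the tight
    -- set of the chosen point.
    have hC : C (Finset.univ.filter fun d => 0 < c d) := by
      refine H.tight f _ hf fun d hd => ?_
      by_contra hne
      exact (Finset.mem_filter.1 hd).2.ne' (hcS d (by simpa using hne))
    refine ⟨_, hC, H.setOf_isMax_eq hC (fun d hd => (Finset.mem_filter.1 hd).2) fun d hd => ?_⟩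
    exact le_antisymm (by simpa using hd) (hc0 d)
  · rintro ⟨S, hS, rfl⟩
    refine ⟨H.heightFace_nonempty hS,
      Module.Dual.eval ℝ V (∑ d, (if d ∈ S then (1 : ℝ) else 0) • v d), ?_⟩
    exact (H.setOf_isMax_eq hS (fun d hd => by simp [hd]) fun d hd => by simp [hd]).symm

theorem normalCone_heightFace (H : IsConvexPresentation n v h C) {S : Finset D} (hS : C S) :
    normalCone (heightPolytope v h) (heightFace v h S) =
      PointedCone.hull ℝ (v '' (S : Set D)) := by
  refine le_antisymm (fun w hw => ?_) (Submodule.span_le.2 ?_)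
  · obtain ⟨f, hf, hfS⟩ := H.exists_tight_iff hS
    exact mem_hull_image_iff.2
      (H.exists_coeff_of_isMax hf hfS fun g hg => hw f ⟨hf, fun d hd => (hfS d).2 hd⟩ g hg)
  · rintro _ ⟨d, hd, rfl⟩ f hf g hg
    rw [hf.2 d hd]
    exact hg d

theorem normalFan_eq (H : IsConvexPresentation n v h C) :
    normalFan (heightPolytope v h) =
      {K | ∃ T, Maximal C T ∧ K.IsFaceOf (PointedCone.hull ℝ (v '' (T : Set D)))} := by
  ext K
  constructor
  · rintro ⟨F, hF, rfl⟩
    obtain ⟨S, hS, rfl⟩ := H.isFace_iff.1 hF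
    obtain ⟨T, hST, hT⟩ := H.exists_maximal hS
    rw [H.normalCone_heightFace hS]
    exact ⟨T, hT, hull_image_isFaceOf (H.linearIndepOn T hT) hST⟩
  · rintro ⟨T, hT, hK⟩
    obtain ⟨S, hST, rfl⟩ := exists_eq_hull_image_of_isFaceOf hK
    have hS := H.mono S T hT.prop hST
    exact ⟨_, H.isFace_iff.2 ⟨S, hS, rfl⟩, (H.normalCone_heightFace hS).symm⟩

/-- For the nontrivial inclusion, start at a point with tight set exactly `S`: every direction
annihilating the vectors of `S` is feasible there. -/
theorem vectorSpan_heightFace (H : IsConvexPresentation n v h C) {S : Finset D} (hS : C S) :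
    vectorSpan ℝ (heightFace v h S) =
      (Submodule.span ℝ (v '' (S : Set D))).dualAnnihilator := by
  refine le_antisymm ?_ fun g hg => ?_
  · rw [vectorSpan_def, Submodule.span_le]
    rintro _ ⟨f, hf, g, hg, rfl⟩
    rw [SetLike.mem_coe, Submodule.mem_dualAnnihilator]
    intro w hw
    have : Submodule.span ℝ (v '' (S : Set D)) ≤ LinearMap.ker (f - g) := by
      rw [Submodule.span_le]
      rintro _ ⟨d, hd, rfl⟩
      simp [hf.2 d hd, hg.2 d hd]
    exact this hw
  · rw [Submodule.mem_dualAnnihilator] at hg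
    have hg0 : ∀ d ∈ S, g (v d) = 0 := fun d hd => hg _ (Submodule.subset_span ⟨d, hd, rfl⟩)
    obtain ⟨f, hf, hfS⟩ := H.exists_tight_iff hS
    obtain ⟨ε, hε, hm, -⟩ := exists_pos_add_smul_mem hf g fun d hd => (hg0 d ((hfS d).1 hd)).le
    have h1 : f ∈ heightFace v h S := ⟨hf, fun d hd => (hfS d).2 hd⟩
    have h2 : f + ε • g ∈ heightFace v h S :=
      ⟨hm, fun d hd => by simp [hg0 d hd, (hfS d).2 hd]⟩
    have h3 := vsub_mem_vectorSpan ℝ h2 h1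
    rw [vsub_eq_sub, add_sub_cancel_left] at h3
    have h4 := Submodule.smul_mem _ ε⁻¹ h3
    rwa [smul_smul, inv_mul_cancel₀ hε.ne', one_smul] at h4

theorem dimension_heightFace (H : IsConvexPresentation n v h C) {S : Finset D} (hS : C S) :
    S.card + dimension (heightFace v h S) = n := by
  have := H.finiteDimensional
  rw [dimension, H.vectorSpan_heightFace hS, ← H.finrank_eq, ← H.finrank_span hS]
  exact Subspace.finrank_add_finrank_dualAnnihilator_eq _

theorem dimension_heightPolytope (H : IsConvexPresentation n v h C) :
    dimension (heightPolytope v h) = n := by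
  simpa [heightFace_empty] using H.dimension_heightFace H.empty

/-- A vertex is the face of some `S` with n elements, and the facets through it are those of the
singletons in `S`. -/
theorem isSimple (H : IsConvexPresentation n v h C) : IsSimple (heightPolytope v h) := by
  classical
  intro x hx
  obtain ⟨S, hS, hxS⟩ := H.isFace_iff.1 hx
  have hdim := H.dimension_heightFace hS
  have h0 : dimension (heightFace v h S) = 0 := by
    rw [← hxS, dimension, vectorSpan_singleton, finrank_bot]
  rw [h0, add_zero] at hdim
  have hxmem : x ∈ heightFace v h S := hxS ▸ Set.mem_singleton x
  have hsing : ∀ d ∈ S, C {d} := fun d hd => H.mono _ _ hS (Finset.singleton_subset_iff.2 hd)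
  have : {F | IsFacet (heightPolytope v h) F ∧ x ∈ F} =
      (fun d => heightFace v h {d}) '' (S : Set D) := by
    ext F
    constructor
    · rintro ⟨⟨hF, hFd⟩, hxF⟩
      obtain ⟨S', hS', rfl⟩ := H.isFace_iff.1 hF
      have h1 := H.dimension_heightFace hS'
      rw [H.dimension_heightPolytope] at hFd
      obtain ⟨d, rfl⟩ := Finset.card_eq_one.1 (by omega : S'.card = 1)
      refine ⟨d, ?_, rfl⟩
      have hsub : heightFace v h S ⊆ heightFace v h {d} := by
        rw [← hxS]
        exact Set.singleton_subset_iff.2 hxF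
      exact Finset.singleton_subset_iff.1 ((H.heightFace_subset_iff hS).1 hsub)
    · rintro ⟨d, hd, rfl⟩
      refine ⟨⟨H.isFace_iff.2 ⟨_, hsing d hd, rfl⟩, ?_⟩,
        (H.heightFace_subset_iff hS).2 (Finset.singleton_subset_iff.2 hd) hxmem⟩
      have h1 := H.dimension_heightFace (hsing d hd)
      rw [Finset.card_singleton] at h1
      rw [H.dimension_heightPolytope]
      dsimp only
      omega
  rw [this, Set.InjOn.encard_image, Set.encard_coe_eq_coe_finsetCard, hdim,
    H.dimension_heightPolytope]
  intro d hd e he hde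
  exact Finset.singleton_injective (H.heightFace_injOn (hsing d hd) (hsing e he) hde)

theorem nonempty_orderIso (H : IsConvexPresentation n v h C) :
    Nonempty ({F : Set (Module.Dual ℝ V) // IsFace (heightPolytope v h) F} ≃o
      {S : Finset D // C S}ᵒᵈ) := by
  let e : {S : Finset D // C S}ᵒᵈ ↪o
      {F : Set (Module.Dual ℝ V) // IsFace (heightPolytope v h) F} :=
    OrderEmbedding.ofMapLEIff
      (fun S => ⟨heightFace v h (OrderDual.ofDual S).1,
        H.isFace_iff.2 ⟨_, (OrderDual.ofDual S).2, rfl⟩⟩)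
      fun S S' => H.heightFace_subset_iff (OrderDual.ofDual S).2
  have he : Function.Surjective e := by
    rintro ⟨F, hF⟩
    obtain ⟨S, hS, rfl⟩ := H.isFace_iff.1 hF
    exact ⟨OrderDual.toDual ⟨S, hS⟩, rfl⟩
  exact ⟨(RelIso.ofSurjective e he).symm⟩

/-- From a point of the polytope one can move in a direction that keeps the tight inequalities
until another inequality becomes tight. -/
theorem exists_more_tight (H : IsConvexPresentation n v h C) {f : Module.Dual ℝ V}
    (hf : f ∈ heightPolytope v h) {g : Module.Dual ℝ V} (hg : g ≠ 0)
    (hgf : ∀ d, f (v d) = h d → g (v d) = 0) :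
    ∃ t : ℝ, 0 < t ∧ f + t • g ∈ heightPolytope v h ∧
      (∀ d, f (v d) = h d → (f + t • g) (v d) = h d) ∧
      ∃ d, f (v d) ≠ h d ∧ (f + t • g) (v d) = h d := by
  classical
  have hne : (Finset.univ.filter fun d => 0 < g (v d)).Nonempty := by
    by_contra hemp
    rw [Finset.not_nonempty_iff_eq_empty, Finset.filter_eq_empty_iff] at hemp
    exact hg (H.bounded g fun d => not_lt.1 (hemp (Finset.mem_univ d)))
  obtain ⟨d, hd, hmin⟩ := Finset.exists_min_image _ (fun d => (h d - f (v d)) / g (v d)) hne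
  have hgd := (Finset.mem_filter.1 hd).2
  have hfd : f (v d) ≠ h d := fun h' => hgd.ne' (hgf d h')
  have ht : 0 < (h d - f (v d)) / g (v d) :=
    div_pos (sub_pos.2 (lt_of_le_of_ne (hf d) hfd)) hgd
  refine ⟨_, ht, fun e => ?_, fun e he => ?_, d, hfd, ?_⟩
  · simp only [LinearMap.add_apply, LinearMap.smul_apply, smul_eq_mul]
    rcases le_or_gt (g (v e)) 0 with hge | hge
    · have := mul_nonpos_of_nonneg_of_nonpos ht.le hge
      have := hf e
      linarith
    · have := (le_div_iff₀ hge).1 (hmin e (by simpa using hge))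
      linarith
  · simp [hgf e he, he]
  · simp only [LinearMap.add_apply, LinearMap.smul_apply, smul_eq_mul]
    rw [div_mul_cancel₀ _ hgd.ne']
    ring

/-- Induction on the number of tight inequalities missing from n. A point with fewer than n lies on
a line that preserves the tight ones; following it both ways until a new inequality becomes tight
writes the point as a convex combination. -/
theorem isPolytope (H : IsConvexPresentation n v h C) : IsPolytope (heightPolytope v h) := by
  classical
  have hfin := H.finiteDimensional
  let tightSet : Module.Dual ℝ V → Finset D := fun f => Finset.univ.filter fun d => f (v d) = h d
  have htight : ∀ f d, d ∈ tightSet f ↔ f (v d) = h d := fun f d => by simp [tightSet]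
  have hC : ∀ f ∈ heightPolytope v h, C (tightSet f) :=
    fun f hf => H.tight f _ hf fun d hd => (htight f d).1 hd
  let s := {f | f ∈ heightPolytope v h ∧ (tightSet f).card = n}
  have hmax : ∀ f ∈ s, Maximal C (tightSet f) := fun f hf => by
    obtain ⟨T, hT1, hT2⟩ := H.exists_maximal (hC f hf.1)
    rwa [Finset.eq_of_subset_of_card_le hT1 (by rw [H.card_eq T hT2, hf.2])]
  have hle : ∀ f ∈ heightPolytope v h, (tightSet f).card ≤ n := fun f hf => by
    obtain ⟨T, hT1, hT2⟩ := H.exists_maximal (hC f hf)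
    exact (Finset.card_le_card hT1).trans (H.card_eq T hT2).le
  have hconv : ∀ m, ∀ f ∈ heightPolytope v h, n - (tightSet f).card ≤ m → f ∈ convexHull ℝ s := by
    intro m
    induction m with
    | zero =>
      intro f hf hm
      exact subset_convexHull ℝ s ⟨hf, le_antisymm (hle f hf) (by omega)⟩
    | succ m ih =>
      intro f hf hm
      by_cases hcard : (tightSet f).card = n
      · exact subset_convexHull ℝ s ⟨hf, hcard⟩
      have hlt := lt_of_le_of_ne (hle f hf) hcard
      have hdim := H.finrank_span (hC f hf)
      have hann := Subspace.finrank_add_finrank_dualAnnihilator_eq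
        (Submodule.span ℝ (v '' (tightSet f : Set D)))
      rw [hdim, H.finrank_eq] at hann
      have hbot : (Submodule.span ℝ (v '' (tightSet f : Set D))).dualAnnihilator ≠ ⊥ := by
        intro hb
        rw [hb, finrank_bot] at hann
        omega
      obtain ⟨g, hg, hg0⟩ := Submodule.exists_mem_ne_zero_of_ne_bot hbot
      rw [Submodule.mem_dualAnnihilator] at hg
      have hgf : ∀ d, f (v d) = h d → g (v d) = 0 := fun d hd =>
        hg _ (Submodule.subset_span ⟨d, (htight f d).2 hd, rfl⟩)
      have step : ∀ g : Module.Dual ℝ V, g ≠ 0 → (∀ d, f (v d) = h d → g (v d) = 0) →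
          ∃ t : ℝ, 0 < t ∧ f + t • g ∈ convexHull ℝ s := by
        intro g hg0 hgf
        obtain ⟨t, ht, hm', hsub, d, hd1, hd2⟩ := H.exists_more_tight hf hg0 hgf
        refine ⟨t, ht, ih _ hm' ?_⟩
        have : (tightSet f).card < (tightSet (f + t • g)).card := by
          refine Finset.card_lt_card (Finset.ssubset_iff_of_subset ?_ |>.2 ⟨d, ?_, ?_⟩)
          · intro e he
            rw [htight] at he ⊢
            exact hsub e he
          · rwa [htight]
          · rwa [htight]
        omega
      obtain ⟨t, ht, h1⟩ := step g hg0 hgf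
      obtain ⟨u, hu, h2⟩ := step (-g) (neg_ne_zero.2 hg0) fun d hd => by simp [hgf d hd]
      have htu : 0 < t + u := add_pos ht hu
      have := convex_convexHull ℝ s h1 h2 (div_pos hu htu).le (div_pos ht htu).le
        (by field_simp; ring)
      convert this using 1
      ext w
      simp only [LinearMap.add_apply, LinearMap.smul_apply, LinearMap.neg_apply, smul_eq_mul]
      field_simp
      ring
  refine ⟨s, ?_, ?_, Set.Subset.antisymm (fun f hf => hconv _ f hf le_rfl)
    (convexHull_min (fun f hf => hf.1) (convex_heightPolytope v h))⟩
  -- A vertex is determined by its tight set, whose vectors span V.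
  · refine Set.Finite.of_finite_image (f := tightSet) (Set.toFinite _) ?_
    intro f hf g hg hfg
    refine LinearMap.ext_on (H.span_eq_top _ (hmax f hf)) ?_
    rintro _ ⟨d, hd, rfl⟩
    rw [(htight f d).1 hd, (htight g d).1 (hfg ▸ hd)]
  · obtain ⟨f, hf, -⟩ := H.exists_tight_iff H.empty
    exact convexHull_nonempty_iff.1 ⟨f, hconv _ f hf le_rfl⟩

end IsConvexPresentation

/-! ### From pairs of vertices to diagonals -/

theorem Crosses.symm {n : ℕ} {d e : Diagonal n} (h : Crosses d e) : Crosses e d :=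
  Or.symm h

theorem crosses_iff {n : ℕ} {d e : Diagonal n} :
    Crosses d e ↔ PairCross d.1.1 d.1.2 e.1.1 e.1.2 := Iff.rfl

theorem not_crosses_self {n : ℕ} (d : Diagonal n) : ¬ Crosses d d := by
  rw [crosses_iff]
  unfold PairCross
  omega

/-- The pairs of labels of the diagonals in `T`. -/
def diagonalPairs {n : ℕ} (T : Finset (Diagonal n)) : Set (ℕ × ℕ) :=
  {e | ∃ d ∈ T, (d.1.1.val, d.1.2.val) = e}

theorem pairsNonCrossing_diagonalPairs {n : ℕ} {T : Finset (Diagonal n)} (hT : IsNonCrossing T) :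
    PairsNonCrossing (diagonalPairs T) := by
  refine ⟨?_, ?_⟩
  · rintro _ ⟨d, -, rfl⟩
    have := d.2.1
    dsimp only
    omega
  · rintro _ ⟨d, hd, rfl⟩ _ ⟨e, he, rfl⟩
    exact hT d hd e he

theorem IsTriangulation.mem_of_forall_not_crosses {n : ℕ} {T : Finset (Diagonal n)}
    (hT : IsTriangulation T) {e : Diagonal n} (he : ∀ d ∈ T, ¬ Crosses d e) : e ∈ T := by
  classical
  have h : IsNonCrossing (insert e T) := by
    intro x hx y hy
    rw [Finset.mem_insert] at hx hy
    rcases hx with hx | hx <;> rcases hy with hy | hy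
    · rw [hx, hy]
      exact not_crosses_self _
    · rw [hx]
      exact fun h => he y hy h.symm
    · rw [hy]
      exact he x hx
    · exact hT.prop x hx y hy
  exact hT.le_of_ge h (Finset.subset_insert e T) (Finset.mem_insert_self e T)

theorem IsTriangulation.mem_or_exists_cross {n : ℕ} {T : Finset (Diagonal n)}
    (hT : IsTriangulation T) (e : Diagonal n) :
    (e.1.1.val, e.1.2.val) ∈ diagonalPairs T ∨
      ∃ k l, (k, l) ∈ diagonalPairs T ∧ PairCross e.1.1 e.1.2 k l := by
  by_cases he : ∃ d ∈ T, Crosses d e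
  · obtain ⟨d, hd, hde⟩ := he
    exact Or.inr ⟨_, _, ⟨d, hd, rfl⟩, hde.symm⟩
  · push Not at he
    exact Or.inl ⟨e, hT.mem_of_forall_not_crosses he, rfl⟩

/-- The height of a diagonal with respect to the seed triangulation `T₀`. -/
noncomputable def santosHeight {n : ℕ} (T₀ : Finset (Diagonal n)) (d : Diagonal n) : ℝ :=
  (pairHeight (diagonalPairs T₀) (n + 3) d.1.1 d.1.2 : ℤ)

section

variable {V : Type*} [AddCommGroup V] [Module ℝ V] {n : ℕ} {T₀ : Finset (Diagonal n)}
  (α : Module.Basis {δ : Diagonal n // δ ∈ T₀} ℝ V)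

/-- The vector of a pair of vertices of the polygon. -/
noncomputable def pairVector (i j : ℕ) : V :=
  ∑ δ : {δ : Diagonal n // δ ∈ T₀}, (compat i j δ.1.1.1 δ.1.1.2 : ℝ) • α δ

theorem santosVector_eq_pairVector (hT₀ : IsNonCrossing T₀) (d : Diagonal n) :
    santosVector α d = pairVector α d.1.1 d.1.2 := by
  classical
  have hinj : ∀ δ : {δ : Diagonal n // δ ∈ T₀},
      d.1.1.val = δ.1.1.1.val ∧ d.1.2.val = δ.1.1.2.val ↔ d = δ.1 := fun δ => by
    rw [Subtype.ext_iff, Prod.ext_iff, Fin.ext_iff, Fin.ext_iff]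
  unfold santosVector pairVector compat
  simp only [hinj, ← crosses_iff]
  split_ifs with hd
  · rw [Finset.sum_eq_single ⟨d, hd⟩]
    · simp
    · intro δ _ hδ
      have : d ≠ δ.1 := fun h => hδ (Subtype.ext h.symm)
      simp [this, hT₀ d hd δ.1 δ.2]
    · simp
  · refine Finset.sum_congr rfl fun δ _ => ?_
    have : d ≠ δ.1 := fun h => hd (h ▸ δ.2)
    by_cases hc : Crosses d δ.1 <;> simp [this, hc]

/-- Sides of a quadrilateral may be edges of the polygon. These match no diagonal, consistently with
their vector being 0. -/
theorem sum_ite_smul_santosVector (hT₀ : IsNonCrossing T₀) {i j : ℕ} (hij : i < j)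
    (hj : j < n + 3) (w : ℝ) :
    ∑ x : Diagonal n, (if x.1.1.val = i ∧ x.1.2.val = j then w else 0) • santosVector α x =
      w • pairVector α i j := by
  classical
  by_cases h : i + 1 < j ∧ ¬ (i = 0 ∧ j = n + 2)
  · rw [Finset.sum_eq_single ⟨(⟨i, by omega⟩, ⟨j, hj⟩), h⟩]
    · rw [santosVector_eq_pairVector α hT₀]
      simp
    · intro x _ hx
      rw [if_neg, zero_smul]
      rintro ⟨rfl, rfl⟩
      exact hx rfl
    · simp
  · rw [Finset.sum_eq_zero]
    · rw [pairVector, Finset.sum_eq_zero, smul_zero]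
      intro δ _
      have h1 := δ.1.2
      have h2 := δ.1.1.2.2
      have : compat i j δ.1.1.1 δ.1.1.2 = 0 := by
        unfold compat PairCross
        split_ifs <;> omega
      rw [this, Int.cast_zero, zero_smul]
    · intro x _
      rw [if_neg, zero_smul]
      rintro ⟨rfl, rfl⟩
      exact h x.2

end

/-- Only an inequality: polygon edges have positive height but drop out of the sum, which favours
the strict inequality wanted. -/
theorem sum_ite_mul_santosHeight_le {n : ℕ} (T₀ : Finset (Diagonal n)) {i j : ℕ} (hij : i < j)
    (hj : j < n + 3) {w : ℝ} (hw : 0 ≤ w) :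
    ∑ x : Diagonal n, (if x.1.1.val = i ∧ x.1.2.val = j then w else 0) * santosHeight T₀ x ≤
      w * (pairHeight (diagonalPairs T₀) (n + 3) i j : ℤ) := by
  classical
  by_cases h : i + 1 < j ∧ ¬ (i = 0 ∧ j = n + 2)
  · rw [Finset.sum_eq_single ⟨(⟨i, by omega⟩, ⟨j, hj⟩), h⟩]
    · simp [santosHeight]
    · intro x _ hx
      rw [if_neg, zero_mul]
      rintro ⟨rfl, rfl⟩
      exact hx rfl
    · simp
  · rw [Finset.sum_eq_zero]
    · exact mul_nonneg hw (by exact_mod_cast (pairHeight_pos _ hij hj).le)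
    · intro x _
      rw [if_neg, zero_mul]
      rintro ⟨rfl, rfl⟩
      exact h x.2

/-- A positive relation between the vectors of the diagonals `d`, `e` and of the sides of the
quadrilateral spanned by them, on which the heights are strictly convex. -/
def HasCrossingRelation {V : Type*} [AddCommGroup V] [Module ℝ V] {n : ℕ} (v : Diagonal n → V)
    (h : Diagonal n → ℝ) (d e : Diagonal n) : Prop :=
  ∃ (s t : ℝ) (c : Diagonal n → ℝ), 0 < s ∧ 0 < t ∧ (∀ x, 0 ≤ c x) ∧
    (∀ x, c x ≠ 0 → ¬ Crosses d x ∧ ¬ Crosses e x ∧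
      ∀ y, Crosses y x → Crosses y d ∨ Crosses y e) ∧
    s • v d + t • v e = ∑ x, c x • v x ∧ ∑ x, c x * h x < s * h d + t * h e

theorem HasCrossingRelation.symm {V : Type*} [AddCommGroup V] [Module ℝ V] {n : ℕ}
    {v : Diagonal n → V} {h : Diagonal n → ℝ} {d e : Diagonal n}
    (H : HasCrossingRelation v h d e) : HasCrossingRelation v h e d := by
  obtain ⟨s, t, c, hs, ht, hc, hx, h1, h2⟩ := H
  exact ⟨t, s, c, ht, hs, hc, fun x hcx => ⟨(hx x hcx).2.1, (hx x hcx).1,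
    fun y hy => ((hx x hcx).2.2 y hy).symm⟩, by rw [← h1, add_comm], by linarith⟩

theorem hasCrossingRelation_of_lt {V : Type*} [AddCommGroup V] [Module ℝ V] {n : ℕ}
    {T₀ : Finset (Diagonal n)} (hT₀ : IsTriangulation T₀)
    (α : Module.Basis {δ : Diagonal n // δ ∈ T₀} ℝ V) {p q : Diagonal n}
    (hab : p.1.1 < q.1.1) (hbc : q.1.1 < p.1.2) (hcd : p.1.2 < q.1.2) :
    HasCrossingRelation (santosVector α) (santosHeight T₀) p q := by
  obtain ⟨⟨⟨a, ha⟩, ⟨c, hc⟩⟩, hp⟩ := p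
  obtain ⟨⟨⟨b, hb⟩, ⟨d, hd⟩⟩, hq⟩ := q
  simp only [Fin.mk_lt_mk] at hab hbc hcd
  have hpT := hT₀.mem_or_exists_cross ⟨(⟨a, ha⟩, ⟨c, hc⟩), hp⟩
  have hqT := hT₀.mem_or_exists_cross ⟨(⟨b, hb⟩, ⟨d, hd⟩), hq⟩
  obtain ⟨s, t, w, x, y, z, hs, ht, hrel, hht⟩ :=
    hasQuadRelation (pairsNonCrossing_diagonalPairs hT₀.prop) hab hbc hcd hd hpT hqT
  refine ⟨s, t, fun u =>
    (if u.1.1.val = a ∧ u.1.2.val = b then (w : ℝ) else 0) +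
    (if u.1.1.val = b ∧ u.1.2.val = c then (x : ℝ) else 0) +
    (if u.1.1.val = c ∧ u.1.2.val = d then (y : ℝ) else 0) +
    (if u.1.1.val = a ∧ u.1.2.val = d then (z : ℝ) else 0),
    by exact_mod_cast hs, by exact_mod_cast ht, fun u => by positivity, fun u hu => ?_, ?_, ?_⟩
  · have hu' : (u.1.1.val = a ∧ u.1.2.val = b) ∨ (u.1.1.val = b ∧ u.1.2.val = c) ∨
        (u.1.1.val = c ∧ u.1.2.val = d) ∨ (u.1.1.val = a ∧ u.1.2.val = d) := by
      by_contra hcon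
      simp only [not_or] at hcon
      simp [hcon] at hu
    simp only [crosses_iff]
    unfold PairCross
    rcases hu' with ⟨h1, h2⟩ | ⟨h1, h2⟩ | ⟨h1, h2⟩ | ⟨h1, h2⟩ <;> rw [h1, h2] <;>
      exact ⟨by omega, by omega, fun v hv => by omega⟩
  · simp only [add_smul, Finset.sum_add_distrib]
    rw [sum_ite_smul_santosVector α hT₀.prop hab hb, sum_ite_smul_santosVector α hT₀.prop hbc hc,
      sum_ite_smul_santosVector α hT₀.prop hcd hd,
      sum_ite_smul_santosVector α hT₀.prop (hab.trans (hbc.trans hcd)) hd,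
      santosVector_eq_pairVector α hT₀.prop, santosVector_eq_pairVector α hT₀.prop]
    simp only [pairVector, Finset.smul_sum, smul_smul, ← Finset.sum_add_distrib, ← add_smul]
    refine Finset.sum_congr rfl fun δ _ => ?_
    congr 1
    exact_mod_cast hrel _ _ ⟨δ.1, δ.2, rfl⟩
  · simp only [add_mul, Finset.sum_add_distrib]
    have h1 := sum_ite_mul_santosHeight_le T₀ hab hb (Nat.cast_nonneg w)
    have h2 := sum_ite_mul_santosHeight_le T₀ hbc hc (Nat.cast_nonneg x)
    have h3 := sum_ite_mul_santosHeight_le T₀ hcd hd (Nat.cast_nonneg y)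
    have h4 := sum_ite_mul_santosHeight_le T₀ (hab.trans (hbc.trans hcd)) hd (Nat.cast_nonneg z)
    refine lt_of_le_of_lt (add_le_add (add_le_add (add_le_add h1 h2) h3) h4) ?_
    unfold santosHeight
    exact_mod_cast hht

theorem hasCrossingRelation {V : Type*} [AddCommGroup V] [Module ℝ V] {n : ℕ}
    {T₀ : Finset (Diagonal n)} (hT₀ : IsTriangulation T₀)
    (α : Module.Basis {δ : Diagonal n // δ ∈ T₀} ℝ V) {p q : Diagonal n} (hpq : Crosses p q) :
    HasCrossingRelation (santosVector α) (santosHeight T₀) p q := by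
  rcases hpq with ⟨h1, h2, h3⟩ | ⟨h1, h2, h3⟩
  · exact hasCrossingRelation_of_lt hT₀ α h1 h2 h3
  · exact (hasCrossingRelation_of_lt hT₀ α h1 h2 h3).symm

/-! ### Triangulations give bases -/

/-- Induction on the number of crossings with a triangulation `T`: a property of diagonals holds
if it holds on `T` and passes from the sides of the quadrilateral of a crossing pair `d ∈ T`, `e`
to `e`. -/
theorem IsTriangulation.induction_on {n : ℕ} {T : Finset (Diagonal n)} (hT : IsTriangulation T)
    {p : Diagonal n → Prop} (mem : ∀ e ∈ T, p e)
    (cross : ∀ d ∈ T, ∀ e, e ∉ T → Crosses d e →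
      (∀ x, (¬ Crosses d x ∧ ¬ Crosses e x ∧ ∀ y, Crosses y x → Crosses y d ∨ Crosses y e) → p x) →
      p e) (e : Diagonal n) : p e := by
  classical
  induction hm : (T.filter fun y => Crosses y e).card using Nat.strong_induction_on generalizing e with
  | _ m ih =>
    by_cases he : e ∈ T
    · exact mem e he
    have hex : ∃ d ∈ T, Crosses d e := by
      by_contra hcon
      push Not at hcon
      exact he (hT.mem_of_forall_not_crosses hcon)
    obtain ⟨d, hd, hde⟩ := hex
    refine cross d hd e he hde fun x ⟨hdx, _, hx⟩ => ih _ ?_ x rfl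
    rw [← hm]
    -- A member of `T` crossing the side x crosses d or e, and it cannot cross d, which is in `T`.
    -- The inclusion is strict because d crosses e but not x.
    refine Finset.card_lt_card ((Finset.ssubset_iff_of_subset fun y hy => ?_).2 ⟨d, ?_, ?_⟩)
    · rw [Finset.mem_filter] at hy ⊢
      exact ⟨hy.1, (hx y hy.2).resolve_left (hT.prop y hy.1 d hd)⟩
    · exact Finset.mem_filter.2 ⟨hd, hde⟩
    · exact fun h => hdx (Finset.mem_filter.1 h).2

theorem span_santosVector_eq_top {V : Type*} [AddCommGroup V] [Module ℝ V] {n : ℕ}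
    {T₀ : Finset (Diagonal n)} (hT₀ : IsTriangulation T₀)
    (α : Module.Basis {δ : Diagonal n // δ ∈ T₀} ℝ V) {T : Finset (Diagonal n)}
    (hT : IsTriangulation T) :
    Submodule.span ℝ (santosVector α '' (T : Set (Diagonal n))) = ⊤ := by
  have key : ∀ e, santosVector α e ∈ Submodule.span ℝ (santosVector α '' (T : Set (Diagonal n))) := by
    refine hT.induction_on (fun e he => Submodule.subset_span ⟨e, he, rfl⟩) ?_
    intro d hd e _ hde ih
    obtain ⟨s, t, c, hs, ht, hc, hx, h1, h2⟩ := hasCrossingRelation hT₀ α hde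
    have h3 : ∑ x, c x • santosVector α x - s • santosVector α d ∈
        Submodule.span ℝ (santosVector α '' (T : Set (Diagonal n))) := by
      refine Submodule.sub_mem _ (Submodule.sum_mem _ fun x _ => ?_)
        (Submodule.smul_mem _ _ (Submodule.subset_span ⟨d, hd, rfl⟩))
      by_cases hcx : c x = 0
      · rw [hcx, zero_smul]
        exact Submodule.zero_mem _
      · exact Submodule.smul_mem _ _ (ih x (hx x hcx))
    rw [← h1, add_sub_cancel_left] at h3
    have h4 := Submodule.smul_mem _ t⁻¹ h3
    rwa [smul_smul, inv_mul_cancel₀ ht.ne', one_smul] at h4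
  rw [← top_le_iff, ← α.span_eq, Submodule.span_le]
  rintro _ ⟨δ, rfl⟩
  have := Submodule.neg_mem _ (key δ.1)
  rwa [santosVector, dif_pos δ.2, neg_neg] at this

/-- A linear algebra argument: with `T₀` as seed, the vectors of `T` span a space of dimension
`T₀.card`. Exchanging the roles gives equality. -/
theorem IsTriangulation.card_le_card {n : ℕ} {T₀ T : Finset (Diagonal n)}
    (hT₀ : IsTriangulation T₀) (hT : IsTriangulation T) : T₀.card ≤ T.card := by
  classical
  let α := Pi.basisFun ℝ {δ : Diagonal n // δ ∈ T₀}
  have h1 := span_santosVector_eq_top hT₀ α hT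
  have h2 := finrank_span_finset_le_card (R := ℝ) (T.image (santosVector α))
  rw [Finset.coe_image, Set.finrank, h1, finrank_top, Module.finrank_eq_card_basis α,
    Fintype.card_coe] at h2
  exact h2.trans Finset.card_image_le

/-- The triangulation by the diagonals at the vertex `0`. -/
def fanTriangulation (n : ℕ) : Finset (Diagonal n) :=
  Finset.univ.image fun k : Fin n =>
    ⟨(⟨0, by omega⟩, ⟨k + 2, by omega⟩), by dsimp only; omega⟩

theorem card_fanTriangulation (n : ℕ) : (fanTriangulation n).card = n := by
  rw [fanTriangulation, Finset.card_image_of_injective, Finset.card_univ, Fintype.card_fin]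
  intro k l hkl
  simpa [Fin.ext_iff] using hkl

theorem isTriangulation_fanTriangulation (n : ℕ) : IsTriangulation (fanTriangulation n) := by
  have hmem : ∀ d : Diagonal n, d ∈ fanTriangulation n ↔ d.1.1.val = 0 := by
    intro d
    unfold fanTriangulation
    rw [Finset.mem_image]
    constructor
    · rintro ⟨k, -, rfl⟩
      rfl
    · intro h
      have h1 := d.2
      have h2 := d.1.2.2
      refine ⟨⟨d.1.2 - 2, by omega⟩, Finset.mem_univ _, Subtype.ext (Prod.ext (Fin.ext h.symm) ?_)⟩
      refine Fin.ext ?_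
      dsimp only
      omega
  refine ⟨fun d hd e he => ?_, fun S hS hsub d hd => ?_⟩
  · rw [hmem] at hd he
    rw [crosses_iff]
    unfold PairCross
    omega
  · rw [hmem]
    by_contra hne
    have h1 := d.2
    have h2 := d.1.2.2
    -- A diagonal that avoids the vertex 0 is crossed by the one from 0 to the successor of its
    -- smaller end.
    refine hS ⟨(⟨0, by omega⟩, ⟨d.1.1 + 1, by omega⟩), by dsimp only; omega⟩
      (hsub ((hmem _).2 rfl)) d hd ?_
    rw [crosses_iff]
    unfold PairCross
    dsimp only
    omega

theorem IsTriangulation.card_eq {n : ℕ} {T : Finset (Diagonal n)} (hT : IsTriangulation T) :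
    T.card = n :=
  (le_antisymm (hT.card_le_card (isTriangulation_fanTriangulation n))
    ((isTriangulation_fanTriangulation n).card_le_card hT)).trans (card_fanTriangulation n)

theorem exists_crosses {n : ℕ} (d : Diagonal n) : ∃ e, Crosses e d := by
  have h1 := d.2
  have h2 := d.1.2.2
  by_cases h : d.1.2.val < n + 2
  · refine ⟨⟨(⟨d.1.1 + 1, by omega⟩, ⟨d.1.2 + 1, by omega⟩), by dsimp only; omega⟩, ?_⟩
    rw [crosses_iff]
    unfold PairCross
    dsimp only
    omega
  · refine ⟨⟨(⟨0, by omega⟩, ⟨d.1.1 + 1, by omega⟩), by dsimp only; omega⟩, ?_⟩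
    rw [crosses_iff]
    unfold PairCross
    dsimp only
    omega

/-! ### Strict convexity of the heights -/

theorem isConvexPresentation_santos {V : Type*} [AddCommGroup V] [Module ℝ V] {n : ℕ}
    {T₀ : Finset (Diagonal n)} (hT₀ : IsTriangulation T₀)
    (α : Module.Basis {δ : Diagonal n // δ ∈ T₀} ℝ V) :
    IsConvexPresentation n (santosVector α) (santosHeight T₀) (IsNonCrossing (n := n)) := by
  classical
  have hspan : ∀ T : Finset (Diagonal n), IsTriangulation T →
      ⊤ ≤ Submodule.span ℝ (Set.range fun d : T => santosVector α d) := fun T hT => by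
    have := span_santosVector_eq_top hT₀ α hT
    rw [Set.image_eq_range] at this
    exact this.ge
  have hlin : ∀ T : Finset (Diagonal n), IsTriangulation T →
      LinearIndependent ℝ fun d : T => santosVector α d := fun T hT => by
    refine linearIndependent_of_top_le_span_of_card_eq_finrank (hspan T hT) ?_
    rw [Module.finrank_eq_card_basis α, Fintype.card_coe, Fintype.card_coe, hT.card_eq, hT₀.card_eq]
  refine ⟨fun S T hT hST d hd e he => hT d (hST hd) e (hST he), ?_, fun T hT => IsTriangulation.card_eq hT, hlin,
    fun T hT => span_santosVector_eq_top hT₀ α hT, fun T hT => ?_, fun f S hf hS d hd e he hde => ?_,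
    fun f hf => ?_⟩
  · intro d hd
    simp at hd
  · let b := Module.Basis.mk (hlin T hT) (hspan T hT)
    let f : Module.Dual ℝ V := b.constr ℝ fun d => santosHeight T₀ d
    have hfT : ∀ d ∈ T, f (santosVector α d) = santosHeight T₀ d := fun d hd => by
      have := b.constr_basis ℝ (fun d => santosHeight T₀ d) ⟨d, hd⟩
      rwa [show b ⟨d, hd⟩ = santosVector α d from Module.Basis.mk_apply _ _ _] at this
    -- The weak bound on the sides and equality at d ∈ `T` give the strict bound at e, by the strict
    -- height inequality.
    have key : ∀ e, f (santosVector α e) ≤ santosHeight T₀ e ∧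
        (e ∉ T → f (santosVector α e) < santosHeight T₀ e) := by
      refine IsTriangulation.induction_on hT (fun e he => ⟨(hfT e he).le, fun h => absurd he h⟩) ?_
      intro d hd e _ hde ih
      obtain ⟨s, t, c, hs, ht, hc, hx, h1, h2⟩ := hasCrossingRelation hT₀ α hde
      have h3 : ∑ x, c x * f (santosVector α x) ≤ ∑ x, c x * santosHeight T₀ x := by
        refine Finset.sum_le_sum fun x _ => ?_
        by_cases hcx : c x = 0
        · simp [hcx]
        · exact mul_le_mul_of_nonneg_left (ih x (hx x hcx)).1 (hc x)
      have h4 := congrArg f h1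
      simp only [map_add, map_sum, map_smul, smul_eq_mul, hfT d hd] at h4
      have h5 : t * f (santosVector α e) < t * santosHeight T₀ e := by linarith
      have h6 := lt_of_mul_lt_mul_left h5 ht.le
      exact ⟨h6.le, fun _ => h6⟩
    exact ⟨f, hfT, fun d hd => (key d).2 hd⟩
  -- If two crossing diagonals were tight, the relation evaluated at `f` would contradict its height
  -- inequality.
  · obtain ⟨s, t, c, hs, ht, hc, hx, h1, h2⟩ := hasCrossingRelation hT₀ α hde
    have h4 := congrArg f h1
    simp only [map_add, map_sum, map_smul, smul_eq_mul, hS d hd, hS e he] at h4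
    have h3 : ∑ x, c x * f (santosVector α x) ≤ ∑ x, c x * santosHeight T₀ x :=
      Finset.sum_le_sum fun x _ => mul_le_mul_of_nonneg_left (hf x) (hc x)
    linarith
  -- The seed vectors -α δ make `f` nonnegative on the basis. Some e crosses δ, so f(α δ) is a term
  -- of the nonpositive sum f(v_e) of nonnegative terms.
  · have hpos : ∀ δ, 0 ≤ f (α δ) := fun δ => by
      have := hf δ.1
      rw [santosVector, dif_pos δ.2, map_neg] at this
      linarith
    refine α.ext fun δ => le_antisymm ?_ (hpos δ)
    obtain ⟨e, he⟩ := exists_crosses δ.1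
    have heT : e ∉ T₀ := fun h => hT₀.prop e h δ.1 δ.2 he
    have := hf e
    rw [santosVector, dif_neg heT, map_sum] at this
    refine le_trans ?_ this
    refine le_trans (le_of_eq ?_) (Finset.single_le_sum
      (f := fun δ => f (if Crosses e δ.1 then α δ else 0)) (fun i _ => ?_) (Finset.mem_univ δ))
    · simp [he]
    · split_ifs
      · exact hpos i
      · simp

theorem mainTheorem5 {V : Type*} [AddCommGroup V] [Module ℝ V] (n : ℕ)
    (T₀ : Finset (Diagonal n)) (hT₀ : IsTriangulation T₀)
    (α : Module.Basis {δ : Diagonal n // δ ∈ T₀} ℝ V) :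
    ∃ P : Set (Module.Dual ℝ V), IsAssociahedron n P ∧ normalFan P = santosFan α := by
  have H := isConvexPresentation_santos hT₀ α
  exact ⟨heightPolytope (santosVector α) (santosHeight T₀),
    ⟨H.isPolytope, H.dimension_heightPolytope, H.isSimple, H.nonempty_orderIso⟩, H.normalFan_eq⟩
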